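/- **Setting.** Let $P$ be an ergodic (irreducible and aperiodic) transition matrix on a finite set $\Omega$ with stationary distribution $\mu$, and let $z_1,z_2,\dots$ be a time-homogeneous Markov chain with transition matrix $P$ and arbitrary initial distribution. With $\|p-q\|_{TV}=\sup_{A\subseteq\Omega}|p(A)-q(A)|$ put $$d_{\mathrm{mix}}(t)=\sup_{z\in\Omega}\|P^t(z,\cdot)-\mu\|_{TV},\qquad \tau_{\mathrm{mix}}=\inf\{t\ge 1:\ d_{\mathrm{mix}}(t)\le 1/4\}.$$ Let $f:\mathbb R^d\times\Omega\to\mathbb R$ be such that each $f(\cdot;z)$ is differentiable, and let $F(w)=\mathbb E_{z\sim\mu}[f(w;z)]$. Assume that, for some $M>0$, $L\ge 0$, $G>0$ and all $w,x,y\in\mathbb R^d$, $z\in\Omega$, $$\|\nabla f(w;z)\|\le G,\qquad |F(w)|\le M,\qquad \|\nabla F(x)-\nabla F(y)\|\le L\|x-y\| .$$ **Algorithm (MAG, scaling parameter $\alpha=1$, no projection).** Input: an integer $T\ge 1$ and a point $w_1\in\mathbb R^d$. Let $J_1,J_2,\dots$ be i.i.d. with $\mathbb P(J_t=j)=2^{-j}$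 for $j\ge1$, independent of the chain. In iteration $t=1,\dots,T$, let $z_t^{(1)},z_t^{(2)},\dots$ be the samples of the chain that follow those consumed in iterations $1,\dots,t-1$, let $g_t^{j}=2^{-j}\sum_{i=1}^{2^j}\nabla f(w_t;z_t^{(i)})$, and set $$g_t=g_t^{0}+\begin{cases}2^{J_t}\bigl(g_t^{J_t}-g_t^{J_t-1}\bigr), & 2^{J_t}\le T,\\ 0,&\text{otherwise,}\end{cases}\qquad w_{t+1}=w_t-\eta_t g_t,\qquad \eta_t=\Bigl(\sum_{k=1}^t\|g_k\|^2\Bigr)^{-1/2}$$ (with $w_{t+1}=w_t$ if $g_1=\dots=g_t=0$). Iteration $t$ consumes $N_t=2^{J_t}$ samples if $2^{J_t}\le T$; otherwise only $g_t^0$ is needed, and it consumes $N_t=\nu(J_t)\ge 1$ samples, where $\nu$ is any fixed function with positive integer values (for example $\nu(j)=1$ or $\nu(j)=2^{j}$). The algorithm does not use $\tau_{\mathrm{mix}}$. Let $\tilde w_T=w_I$, where $I$ is uniform on $\{1,\dots,T\}$ and independent of the chain and of $(J_t)$. **Statement.** There are absolute constants $C>0$ and $p\in\mathbb N$, independent of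 the chain, $d$, $f$, $M$, $L$, $G$, $T$, $w_1$ and $\nu$, such that always $\|\nabla F(\tilde w_T)\|$ is integrable and $$\mathbb E\bigl[\|\nabla F(\tilde w_T)\|\bigr]\ \le\ C\,(1+\log T)^p\,\sqrt{(M+L+G)\,G}\,\Bigl(\frac{\tau_{\mathrm{mix}}}{T}\Bigr)^{1/4}.$$ In particular the algorithm finds an approximate stationary point without knowledge of $\tau_{\mathrm{mix}}$. -/

import Mathlib

open MeasureTheory ProbabilityTheory
open scoped BigOperators Gradient

/-! ### Finite Markov chains and mixing times -/

/-- Ergodicity of a finite transition matrix: irreducible and aperiodic. -/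
structure IsErgodicMatrix {S : Type*} [Fintype S] [DecidableEq S] (P : Matrix S S ℝ) : Prop where
  /-- Every state can be reached from every state. -/
  irreducible : ∀ x y : S, ∃ n : ℕ, 0 < (P ^ n) x y
  /-- The greatest common divisor of the possible return times to any state is `1`. -/
  aperiodic : ∀ (x : S) (k : ℕ), (∀ n : ℕ, 1 ≤ n → 0 < (P ^ n) x x → k ∣ n) → k = 1

/-- `μ` is a stationary probability distribution of the transition matrix `P`. -/
structure IsStationaryDistribution {S : Type*} [Fintype S] (P : Matrix S S ℝ) (μ : S → ℝ) :
    Prop where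
  mem_stdSimplex : μ ∈ stdSimplex ℝ S
  stationary : Matrix.vecMul μ P = μ

/-- Total variation distance of two distributions on a finite set: the supremum over all events of
the absolute difference of their probabilities. -/
noncomputable def tvDist {S : Type*} (p q : S → ℝ) : ℝ :=
  ⨆ A : Finset S, |∑ z ∈ A, p z - ∑ z ∈ A, q z|

/-- Distance from stationarity after `t` steps, uniformly in the starting state. -/
noncomputable def dMix {S : Type*} [Fintype S] [DecidableEq S] (P : Matrix S S ℝ) (μ : S → ℝ)
    (t : ℕ) : ℝ :=
  ⨆ z : S, tvDist ((P ^ t) z) μ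

/-- The mixing time `τ_mix(ε)`: the least time `t ≥ 1` with `dMix t ≤ ε`. -/
noncomputable def mixingTimeAt {S : Type*} [Fintype S] [DecidableEq S] (P : Matrix S S ℝ)
    (μ : S → ℝ) (ε : ℝ) : ℕ :=
  sInf {t : ℕ | 1 ≤ t ∧ dMix P μ t ≤ ε}

/-- The mixing time `τ_mix = τ_mix(1/4)`. -/
noncomputable def mixingTime {S : Type*} [Fintype S] [DecidableEq S] (P : Matrix S S ℝ)
    (μ : S → ℝ) : ℕ :=
  mixingTimeAt P μ (1 / 4)

/-- `Z 0, Z 1, …` is a time-homogeneous Markov chain with transition matrix `P` (and an arbitrary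
initial distribution) on the probability space `(Ω, ρ)`. -/
structure IsMarkovChain {Ω : Type*} [MeasurableSpace Ω] {S : Type*} [MeasurableSpace S]
    (P : Matrix S S ℝ) (Z : ℕ → Ω → S) (ρ : Measure Ω) : Prop where
  measurable : ∀ n, Measurable (Z n)
  transition : ∀ (n : ℕ) (x : ℕ → S),
    ρ.real {ω | ∀ i ≤ n + 1, Z i ω = x i} =
      ρ.real {ω | ∀ i ≤ n, Z i ω = x i} * P (x n) (x (n + 1))

/-! ### The stochastic optimization problem -/

/-- The objective `F(w) = E_{z ∼ μ}[f(w; z)]`. -/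
noncomputable def objective {S : Type*} [Fintype S] {d : ℕ}
    (f : EuclideanSpace ℝ (Fin d) → S → ℝ) (μ : S → ℝ) (w : EuclideanSpace ℝ (Fin d)) : ℝ :=
  ∑ z, μ z * f w z

/-- The losses `f(·; z)` are differentiable with gradients bounded by `G`. -/
structure HasBoundedGradients {S : Type*} {d : ℕ} (f : EuclideanSpace ℝ (Fin d) → S → ℝ)
    (G : ℝ) : Prop where
  differentiable : ∀ z, Differentiable ℝ (fun w => f w z)
  bound : ∀ w z, ‖∇ (fun v => f v z) w‖ ≤ G

/-- `F` is `L`-smooth on `ℝ^d`: differentiable with `L`-Lipschitz gradient. -/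
structure IsLSmooth {d : ℕ} (F : EuclideanSpace ℝ (Fin d) → ℝ) (L : ℝ) : Prop where
  differentiable : Differentiable ℝ F
  lipschitz : ∀ x y, ‖∇ F x - ∇ F y‖ ≤ L * ‖x - y‖

/-! ### The algorithm MAG

All the definitions below are deterministic: they describe the run of the algorithm on one
realization `z 0, z 1, …` of the data and `j 0, j 1, …` of the random levels. -/

/-- The average `g^i` at the point `w` of the gradients over the `2 ^ i` samples which follow the
first `s` samples. -/
noncomputable def batchGrad {S : Type*} {d : ℕ} (f : EuclideanSpace ℝ (Fin d) → S → ℝ)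
    (z : ℕ → S) (s : ℕ) (w : EuclideanSpace ℝ (Fin d)) (i : ℕ) : EuclideanSpace ℝ (Fin d) :=
  ((2 : ℝ) ^ i)⁻¹ • ∑ k ∈ Finset.range (2 ^ i), ∇ (fun v => f v (z (s + k))) w

/-- The multi-level Monte Carlo gradient estimator at the point `w`, for the level `i ≥ 1`, using
the samples which follow the first `s` samples. -/
noncomputable def mlmcGrad {S : Type*} {d : ℕ} (f : EuclideanSpace ℝ (Fin d) → S → ℝ) (T : ℕ)
    (z : ℕ → S) (s : ℕ) (w : EuclideanSpace ℝ (Fin d)) (i : ℕ) : EuclideanSpace ℝ (Fin d) :=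
  batchGrad f z s w 0 +
    if 2 ^ i ≤ T then (2 : ℝ) ^ i • (batchGrad f z s w i - batchGrad f z s w (i - 1)) else 0

/-- The state of the algorithm between two iterations. -/
structure MAGState (d : ℕ) where
  /-- The current iterate. -/
  point : EuclideanSpace ℝ (Fin d)
  /-- The sum of the squared norms of the gradient estimators so far. -/
  sumSq : ℝ
  /-- The number of samples of the Markov chain consumed so far. -/
  used : ℕ

/-- One iteration of the (unconstrained) algorithm with data `z` and level `i`. The function `N`
tells how many samples the iteration consumes, as a function of its level. -/
noncomputable def magStep {S : Type*} {d : ℕ} (f : EuclideanSpace ℝ (Fin d) → S → ℝ) (α : ℝ)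
    (T : ℕ) (N : ℕ → ℕ) (z : ℕ → S) (i : ℕ) (σ : MAGState d) : MAGState d :=
  let g := mlmcGrad f T z σ.used σ.point i
  let v := σ.sumSq + ‖g‖ ^ 2
  { point := σ.point - (α / √v) • g
    sumSq := v
    used := σ.used + N i }

/-- The state of the algorithm after `t` iterations, started at `w₁`. -/
noncomputable def magState {S : Type*} {d : ℕ} (f : EuclideanSpace ℝ (Fin d) → S → ℝ) (α : ℝ)
    (T : ℕ) (N : ℕ → ℕ) (w₁ : EuclideanSpace ℝ (Fin d)) (z : ℕ → S) (j : ℕ → ℕ) :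
    ℕ → MAGState d
  | 0 => { point := w₁, sumSq := 0, used := 0 }
  | t + 1 => magStep f α T N z (j t) (magState f α T N w₁ z j t)

/-- The iterate after `t` iterations; with iterates numbered from `1` this is `w_{t+1}`. -/
noncomputable def magIterate {S : Type*} {d : ℕ} (f : EuclideanSpace ℝ (Fin d) → S → ℝ) (α : ℝ)
    (T : ℕ) (N : ℕ → ℕ) (w₁ : EuclideanSpace ℝ (Fin d)) (z : ℕ → S) (j : ℕ → ℕ) (t : ℕ) :
    EuclideanSpace ℝ (Fin d) :=
  (magState f α T N w₁ z j t).point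

/-- The number of consumed samples as a function of the level: it is `2 ^ i` for the levels `i`
with `2 ^ i ≤ T`. When `2 ^ i > T` the estimator looks at one sample only; then the algorithm may
consume any positive number of samples (for example `1`, or `2 ^ i` again). -/
structure IsSampleCount (T : ℕ) (N : ℕ → ℕ) : Prop where
  eq_two_pow : ∀ i, 2 ^ i ≤ T → N i = 2 ^ i
  pos : ∀ i, 1 ≤ N i

/-- The internal randomness of the algorithm: the levels `J 0, J 1, …` are i.i.d. with the geometric
distribution `P(J = i) = 2^{-i}`, `i ≥ 1`, and independent of the data `Z`; the index `I` of the
returned iterate is uniform on `T` values and independent of the data and the levels. -/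
structure IsMAGRandomness {Ω : Type*} [MeasurableSpace Ω] {S : Type*} [MeasurableSpace S] (T : ℕ)
    (Z : ℕ → Ω → S) (J : ℕ → Ω → ℕ) (I : Ω → Fin T) (ρ : Measure Ω) : Prop where
  measurable_level : ∀ t, Measurable (J t)
  measurable_index : Measurable I
  geometric : ∀ t i : ℕ, 1 ≤ i → ρ.real {ω | J t ω = i} = (1 / 2) ^ i
  uniform : ∀ t : Fin T, ρ.real {ω | I ω = t} = 1 / T
  indep_levels : iIndepFun J ρ
  indep_data : IndepFun (fun ω t => J t ω) (fun ω n => Z n ω) ρ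
  indep_index : IndepFun I (fun ω => ((fun t => J t ω), (fun n => Z n ω))) ρ

/-! ### Convergence of ergodic chains in the row-sum norm -/

/-! The proof combines a pathwise regret bound with two moments of the multi-level estimator g_t.

Let v_t be the running sum of the ‖g_k‖². Multiplying the smoothness inequality for one step by √v
and summing by parts gives Σ⟨∇F(w_t), g_t⟩ ≤ (2M+2L)√(Σ‖g_t‖²) on every realization
(`IsLSmooth.sum_inner_le`). The dependence of the step size on g_t therefore never has to be
controlled in expectation.

Level i has probability 2^{-i} and its correction has weight 2^i. Tested against ∇F(w_t), the
estimator thus telescopes in mean to the average over 2^⌊log₂ T⌋ > T/2 samples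
(`IsMAGRandomness.integral_inner_stepGrad`), whose bias is of order τG²/T. In the second moment,
level i contributes about 2^{-i}·4^i·τG²/2^i, so each of the log₂ T levels costs order τG²
(`IsMAGRandomness.integral_norm_stepGrad_sq_le`). The averaged squared gradient is then at most of
order (M+L+G)G(1+log T)√(τ/T), and Jensen's inequality produces the fourth root.

The bias and variance of a batch rest on one fact: the noise of a sample m steps after the past is
correlated with it by at most a multiple of 2^{-⌊m/τ⌋} (`rowBound_pow_sub_constRows`), and these
factors sum to O(τ). The position of a batch in the chain is random, since it depends on earlier
levels. As the levels are independent of the chain, they can be frozen first; an iterate is then a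
function of a fixed number of samples, and the bounds are uniform in the frozen levels. -/

/-- Every row of `A` has `ℓ¹`-norm at most `c`. -/
def RowBound {S : Type*} [Fintype S] (A : Matrix S S ℝ) (c : ℝ) : Prop :=
  ∀ x, ∑ y, |A x y| ≤ c

/-- The matrix all of whose rows are `μ`. -/
def constRows {S : Type*} (μ : S → ℝ) : Matrix S S ℝ := Matrix.of fun _ => μ

section Mixing

variable {S : Type*} [Fintype S] [DecidableEq S]

omit [DecidableEq S] in
lemma RowBound.mul {A B : Matrix S S ℝ} {a b : ℝ} (hA : RowBound A a) (hB : RowBound B b)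
    (hb : 0 ≤ b) : RowBound (A * B) (a * b) := by
  intro x
  calc ∑ z, |(A * B) x z| ≤ ∑ z, ∑ y, |A x y| * |B y z| := by
        refine Finset.sum_le_sum fun z _ => ?_
        rw [Matrix.mul_apply]
        refine (Finset.abs_sum_le_sum_abs _ _).trans_eq ?_
        simp [abs_mul]
    _ = ∑ y, |A x y| * ∑ z, |B y z| := by
        rw [Finset.sum_comm]
        simp [Finset.mul_sum]
    _ ≤ ∑ y, |A x y| * b :=
        Finset.sum_le_sum fun y _ => mul_le_mul_of_nonneg_left (hB y) (abs_nonneg _)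
    _ = (∑ y, |A x y|) * b := by rw [Finset.sum_mul]
    _ ≤ a * b := mul_le_mul_of_nonneg_right (hA x) hb

omit [DecidableEq S] in
lemma constRows_mul {μ : S → ℝ} {A : Matrix S S ℝ} (h : Matrix.vecMul μ A = μ) :
    constRows μ * A = constRows μ := by
  ext x y
  have := congrFun h y
  simpa [constRows, Matrix.mul_apply, Matrix.vecMul, dotProduct] using this

lemma mul_constRows {μ : S → ℝ} {A : Matrix S S ℝ} (h : A ∈ Matrix.rowStochastic ℝ S) :
    A * constRows μ = constRows μ := by
  ext x y
  simp [constRows, Matrix.mul_apply, ← Finset.sum_mul, Matrix.sum_row_of_mem_rowStochastic h]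

lemma constRows_mem_rowStochastic {μ : S → ℝ} (h : μ ∈ stdSimplex ℝ S) :
    constRows μ ∈ Matrix.rowStochastic ℝ S :=
  Matrix.mem_rowStochastic_iff_sum.2 ⟨fun _ j => h.1 j, fun _ => h.2⟩

/-- With Π = `constRows μ`, the identities AΠ = Π, ΠB = Π and ΠΠ = Π collapse the product.
Deviations from stationarity are therefore multiplicative, and submultiplicativity of the row norm
gives geometric decay. -/
lemma sub_constRows_mul_sub_constRows {μ : S → ℝ} (hμ : μ ∈ stdSimplex ℝ S)
    {A B : Matrix S S ℝ} (hA : A ∈ Matrix.rowStochastic ℝ S) (hB : Matrix.vecMul μ B = μ) :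
    (A - constRows μ) * (B - constRows μ) = A * B - constRows μ := by
  rw [sub_mul, mul_sub, mul_sub, mul_constRows hA, constRows_mul hB,
    mul_constRows (constRows_mem_rowStochastic hμ)]
  abel

lemma vecMul_pow_eq {μ : S → ℝ} {A : Matrix S S ℝ} (h : Matrix.vecMul μ A = μ) (n : ℕ) :
    Matrix.vecMul μ (A ^ n) = μ := by
  induction n with
  | zero => simp
  | succ n ih => rw [pow_succ, ← Matrix.vecMul_vecMul, ih, h]

lemma sub_constRows_pow {μ : S → ℝ} (hμ : μ ∈ stdSimplex ℝ S) {A : Matrix S S ℝ}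
    (hA : A ∈ Matrix.rowStochastic ℝ S) (h : Matrix.vecMul μ A = μ) (n : ℕ) :
    (A - constRows μ) ^ (n + 1) = A ^ (n + 1) - constRows μ := by
  induction n with
  | zero => simp
  | succ n ih =>
    rw [pow_succ, ih, sub_constRows_mul_sub_constRows hμ (pow_mem hA _) h, ← pow_succ]

lemma rowBound_sub_of_mem_rowStochastic {A B : Matrix S S ℝ} (hA : A ∈ Matrix.rowStochastic ℝ S)
    (hB : B ∈ Matrix.rowStochastic ℝ S) : RowBound (A - B) 2 := by
  intro x
  calc ∑ y, |(A - B) x y| ≤ ∑ y, (A x y + B x y) := by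
        refine Finset.sum_le_sum fun y _ => ?_
        have h1 := hA.1 x y
        have h2 := hB.1 x y
        rw [Matrix.sub_apply, abs_le]
        constructor <;> linarith
    _ = 2 := by
        rw [Finset.sum_add_distrib, Matrix.sum_row_of_mem_rowStochastic hA,
          Matrix.sum_row_of_mem_rowStochastic hB]
        norm_num

/-! ### Positivity of large powers and Doeblin's contraction. -/

lemma mul_pow_apply_le_pow_add_apply {P : Matrix S S ℝ} (hP : P ∈ Matrix.rowStochastic ℝ S)
    (x y z : S) (m n : ℕ) : (P ^ m) x y * (P ^ n) y z ≤ (P ^ (m + n)) x z := by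
  rw [pow_add, Matrix.mul_apply]
  exact Finset.single_le_sum (f := fun y => (P ^ m) x y * (P ^ n) y z)
    (fun i _ => mul_nonneg ((pow_mem hP m).1 _ _) ((pow_mem hP n).1 _ _)) (Finset.mem_univ y)

/-- The submonoid of return times to a state. -/
def returnTimes {P : Matrix S S ℝ} (hP : P ∈ Matrix.rowStochastic ℝ S) (x : S) :
    AddSubmonoid ℕ where
  carrier := {n | 0 < (P ^ n) x x}
  zero_mem' := by simp
  add_mem' := fun {m n} hm hn =>
    (mul_pos hm hn).trans_le (mul_pow_apply_le_pow_add_apply hP x x x m n)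

/-- The return times to x form an additive submonoid of ℕ with gcd 1, hence contain all large
integers; a long loop at x followed by one path to y reaches y at every large time. -/
lemma IsErgodicMatrix.eventually_pos {P : Matrix S S ℝ} (hP : P ∈ Matrix.rowStochastic ℝ S)
    (h : IsErgodicMatrix P) : ∀ᶠ n : ℕ in Filter.atTop, ∀ x y, 0 < (P ^ n) x y := by
  rw [Filter.eventually_all]
  intro x
  rw [Filter.eventually_all]
  intro y
  obtain ⟨m, hm⟩ := h.irreducible x y
  obtain ⟨k, hk⟩ := Nat.exists_mem_closure_of_ge (returnTimes hP x : Set ℕ)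
  have hgcd : Nat.setGcd (returnTimes hP x : Set ℕ) = 1 :=
    h.aperiodic x _ fun n _ hn => Nat.setGcd_dvd_of_mem hn
  rw [Filter.eventually_atTop]
  refine ⟨k + m, fun n hn => ?_⟩
  have hret : 0 < (P ^ (n - m)) x x := by
    have := hk (n - m) (by omega) (by rw [hgcd]; exact one_dvd _)
    rwa [AddSubmonoid.closure_eq] at this
  have := mul_pow_apply_le_pow_add_apply hP x x y (n - m) m
  rw [Nat.sub_add_cancel (by omega)] at this
  exact (mul_pos hret hm).trans_le this

/-- Doeblin's minorization: once all entries of P^n are at least δ, P^n = δΠ + (1-δ)R with R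
stochastic and μ still stationary for R. Hence P^n - Π = (1-δ)(R - Π), and powers shrink like
(1-δ)^k. -/
lemma IsErgodicMatrix.exists_rowBound {P : Matrix S S ℝ} {μ : S → ℝ}
    (hP : P ∈ Matrix.rowStochastic ℝ S) (h : IsErgodicMatrix P)
    (hμ : IsStationaryDistribution P μ) {ε : ℝ} (hε : 0 < ε) :
    ∃ t, 1 ≤ t ∧ RowBound (P ^ t - constRows μ) ε := by
  obtain ⟨n, hn, hn1⟩ := ((h.eventually_pos hP).and (Filter.eventually_ge_atTop 1)).exists
  have hS : Nonempty S := by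
    by_contra hS
    rw [not_nonempty_iff] at hS
    have := hμ.mem_stdSimplex.2
    simp at this
  obtain ⟨a, ha⟩ := Finite.exists_min (fun q : S × S => (P ^ n) q.1 q.2)
  -- The cap 1/2 keeps 1 - δ positive, which would fail for a single state, where the minimal entry
  -- is 1.
  set δ : ℝ := min ((P ^ n) a.1 a.2) (1 / 2) with hδ
  have hδ0 : 0 < δ := lt_min (hn _ _) (by norm_num)
  have hδ1 : δ ≤ 1 / 2 := min_le_right _ _
  have hδP : ∀ x y, δ ≤ (P ^ n) x y := fun x y => (min_le_left _ _).trans (ha (x, y))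
  have hPn := pow_mem hP n
  have hμ1 : ∀ y, μ y ≤ 1 := fun y => by
    rw [← hμ.mem_stdSimplex.2]
    exact Finset.single_le_sum (fun i _ => hμ.mem_stdSimplex.1 i) (Finset.mem_univ y)
  set R : Matrix S S ℝ := (1 - δ)⁻¹ • (P ^ n - δ • constRows μ) with hR
  have hδ' : 0 < 1 - δ := by linarith
  have hRs : R ∈ Matrix.rowStochastic ℝ S := by
    refine Matrix.mem_rowStochastic_iff_sum.2 ⟨fun x y => ?_, fun x => ?_⟩
    · simp only [hR, Matrix.smul_apply, Matrix.sub_apply, smul_eq_mul, constRows, Matrix.of_apply]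
      have h1 := hδP x y
      have h2 := mul_le_mul_of_nonneg_left (hμ1 y) hδ0.le
      exact mul_nonneg (inv_nonneg.2 hδ'.le) (by linarith)
    · simp only [hR, Matrix.smul_apply, Matrix.sub_apply, smul_eq_mul, constRows, Matrix.of_apply]
      rw [← Finset.mul_sum, Finset.sum_sub_distrib, ← Finset.mul_sum,
        Matrix.sum_row_of_mem_rowStochastic hPn, hμ.mem_stdSimplex.2, mul_one,
        inv_mul_cancel₀ hδ'.ne']
  have hdec : P ^ n - constRows μ = (1 - δ) • (R - constRows μ) := by
    rw [hR, smul_sub, smul_inv_smul₀ hδ'.ne', sub_smul, one_smul]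
    abel
  have hRμ : Matrix.vecMul μ R = μ := by
    have h1 : Matrix.vecMul μ (constRows μ) = μ := by
      ext y
      simp [constRows, Matrix.vecMul, dotProduct, ← Finset.sum_mul, hμ.mem_stdSimplex.2]
    rw [hR, Matrix.vecMul_smul, Matrix.vecMul_sub, Matrix.vecMul_smul, h1,
      vecMul_pow_eq hμ.stationary]
    rw [show μ - δ • μ = (1 - δ) • μ by rw [sub_smul, one_smul], inv_smul_smul₀ hδ'.ne']
  obtain ⟨k, hk⟩ := exists_pow_lt_of_lt_one (half_pos hε) (show 1 - δ < 1 by linarith)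
  refine ⟨n * (k + 1), Nat.one_le_iff_ne_zero.2 (by positivity), ?_⟩
  have hpow : P ^ (n * (k + 1)) - constRows μ
      = (1 - δ) ^ (k + 1) • (R ^ (k + 1) - constRows μ) := by
    rw [pow_mul, ← sub_constRows_pow hμ.mem_stdSimplex hPn (vecMul_pow_eq hμ.stationary n), hdec,
      smul_pow, sub_constRows_pow hμ.mem_stdSimplex hRs hRμ]
  intro x
  have hb := rowBound_sub_of_mem_rowStochastic (pow_mem hRs (k + 1))
    (constRows_mem_rowStochastic hμ.mem_stdSimplex) x
  rw [hpow]
  simp only [Matrix.smul_apply, smul_eq_mul, abs_mul, ← Finset.mul_sum]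
  rw [abs_of_pos (pow_pos hδ' _)]
  have h1 : (1 - δ) ^ (k + 1) ≤ (1 - δ) ^ k :=
    pow_le_pow_of_le_one hδ'.le (by linarith) (Nat.le_succ k)
  calc _ ≤ (1 - δ) ^ (k + 1) * 2 := mul_le_mul_of_nonneg_left hb (by positivity)
    _ ≤ ε := by linarith

/-! ### Total variation, row sums and the mixing time. -/

omit [DecidableEq S] in
lemma abs_sum_sub_sum_le (p q : S → ℝ) (A : Finset S) :
    |∑ z ∈ A, p z - ∑ z ∈ A, q z| ≤ ∑ z, |p z - q z| := by
  rw [← Finset.sum_sub_distrib]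
  exact (Finset.abs_sum_le_sum_abs _ _).trans
    (Finset.sum_le_sum_of_subset_of_nonneg (Finset.subset_univ _) fun _ _ _ => abs_nonneg _)

-- The events {q ≤ p} and {p < q} each carry one sign of p - q, and each contributes at most one
-- total variation distance.
omit [DecidableEq S] in
lemma sum_abs_sub_le_two_mul_tvDist (p q : S → ℝ) : ∑ z, |p z - q z| ≤ 2 * tvDist p q := by
  classical
  have hle : ∀ A : Finset S, |∑ z ∈ A, p z - ∑ z ∈ A, q z| ≤ tvDist p q := fun A =>
    le_ciSup (f := fun A : Finset S => |∑ z ∈ A, p z - ∑ z ∈ A, q z|)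
      (Set.finite_range _).bddAbove A
  have h1 := hle (Finset.univ.filter fun z => q z ≤ p z)
  have h2 := hle (Finset.univ.filter fun z => ¬ q z ≤ p z)
  rw [← Finset.sum_sub_distrib] at h1 h2
  rw [← Finset.sum_filter_add_sum_filter_not Finset.univ (fun z => q z ≤ p z)]
  have e1 : ∑ z with q z ≤ p z, |p z - q z| = ∑ z with q z ≤ p z, (p z - q z) :=
    Finset.sum_congr rfl fun z hz => abs_of_nonneg (sub_nonneg.2 (Finset.mem_filter.1 hz).2)
  have e2 : ∑ z with ¬ q z ≤ p z, |p z - q z| = -∑ z with ¬ q z ≤ p z, (p z - q z) := by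
    rw [← Finset.sum_neg_distrib]
    refine Finset.sum_congr rfl fun z hz => abs_of_nonpos ?_
    have := (Finset.mem_filter.1 hz).2
    linarith
  rw [e1, e2]
  have h3 := le_abs_self (∑ z with q z ≤ p z, (p z - q z))
  have h4 := neg_le_abs (∑ z with ¬ q z ≤ p z, (p z - q z))
  linarith

lemma dMix_le_of_rowBound [Nonempty S] {P : Matrix S S ℝ} {μ : S → ℝ} {t : ℕ} {c : ℝ}
    (h : RowBound (P ^ t - constRows μ) c) : dMix P μ t ≤ c :=
  ciSup_le fun x => ciSup_le fun _ => (abs_sum_sub_sum_le _ _ _).trans (h x)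

lemma rowBound_two_mul_dMix (P : Matrix S S ℝ) (μ : S → ℝ) (t : ℕ) :
    RowBound (P ^ t - constRows μ) (2 * dMix P μ t) := by
  intro x
  refine (sum_abs_sub_le_two_mul_tvDist ((P ^ t) x) μ).trans ?_
  gcongr
  exact le_ciSup (f := fun z => tvDist ((P ^ t) z) μ) (Set.finite_range _).bddAbove x

/-- The infimum of the empty set of naturals is 0, so the defining set must be shown nonempty before
its infimum has the defining property; this is where ergodicity enters. -/
lemma mixingTime_spec {P : Matrix S S ℝ} {μ : S → ℝ}
    (hP : P ∈ Matrix.rowStochastic ℝ S) (h : IsErgodicMatrix P)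
    (hμ : IsStationaryDistribution P μ) :
    1 ≤ mixingTime P μ ∧ dMix P μ (mixingTime P μ) ≤ 1 / 4 := by
  have hS : Nonempty S := by
    by_contra hS
    rw [not_nonempty_iff] at hS
    have := hμ.mem_stdSimplex.2
    simp at this
  obtain ⟨t, ht, hb⟩ := h.exists_rowBound hP hμ (show (0 : ℝ) < 1 / 4 by norm_num)
  exact Nat.sInf_mem (s := {t : ℕ | 1 ≤ t ∧ dMix P μ t ≤ 1 / 4}) ⟨t, ht, dMix_le_of_rowBound hb⟩

/-- The distance from stationarity halves every mixing time. -/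
lemma rowBound_pow_sub_constRows {P : Matrix S S ℝ} {μ : S → ℝ}
    (hP : P ∈ Matrix.rowStochastic ℝ S) (h : IsErgodicMatrix P)
    (hμ : IsStationaryDistribution P μ) (t : ℕ) :
    RowBound (P ^ t - constRows μ) (2 * (1 / 2) ^ (t / mixingTime P μ)) := by
  set τ := mixingTime P μ with hτ
  -- The threshold 1/4 is doubled in passing from total variation to row sums, leaving the
  -- contraction factor 1/2.
  have hτb : RowBound (P ^ τ - constRows μ) (1 / 2) := fun x =>
    (rowBound_two_mul_dMix P μ τ x).trans (by
      have := (mixingTime_spec hP h hμ).2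
      linarith)
  have key : ∀ k r : ℕ, RowBound (P ^ (r + τ * k) - constRows μ) (2 * (1 / 2) ^ k) := by
    intro k r
    induction k with
    | zero =>
      simpa using rowBound_sub_of_mem_rowStochastic (pow_mem hP r)
        (constRows_mem_rowStochastic hμ.mem_stdSimplex)
    | succ k ih =>
      have := ih.mul hτb (by norm_num)
      rwa [sub_constRows_mul_sub_constRows hμ.mem_stdSimplex (pow_mem hP _)
        (vecMul_pow_eq hμ.stationary τ), ← pow_add, mul_assoc, ← pow_succ,
        show r + τ * k + τ = r + τ * (k + 1) by ring] at this
  have := key (t / τ) (t % τ)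
  rwa [Nat.mod_add_div] at this

end Mixing

/-- The exponent is constant on blocks of length τ, so the sum is at most τ times a geometric
series. -/
lemma sum_half_pow_div_le {τ : ℕ} (hτ : 1 ≤ τ) (n : ℕ) :
    ∑ t ∈ Finset.range n, 2 * (1 / 2 : ℝ) ^ (t / τ) ≤ 4 * τ := by
  have key : ∀ k : ℕ, ∑ t ∈ Finset.range (τ * k), 2 * (1 / 2 : ℝ) ^ (t / τ)
      = 4 * τ * (1 - (1 / 2) ^ k) := by
    intro k
    induction k with
    | zero => simp
    | succ k ih =>
      rw [Nat.mul_succ, Finset.sum_range_add, ih]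
      have : ∀ r ∈ Finset.range τ, 2 * (1 / 2 : ℝ) ^ ((τ * k + r) / τ) = 2 * (1 / 2) ^ k := by
        intro r hr
        rw [Nat.mul_add_div (by omega), Nat.div_eq_of_lt (Finset.mem_range.1 hr), add_zero]
      rw [Finset.sum_congr rfl this, Finset.sum_const, Finset.card_range, nsmul_eq_mul, pow_succ]
      ring
  calc _ ≤ ∑ t ∈ Finset.range (τ * n), 2 * (1 / 2 : ℝ) ^ (t / τ) :=
        Finset.sum_le_sum_of_subset_of_nonneg
          (Finset.range_mono (Nat.le_mul_of_pos_left n hτ)) fun _ _ _ => by positivity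
    _ = 4 * τ * (1 - (1 / 2) ^ n) := key n
    _ ≤ 4 * τ * 1 := by
        gcongr
        have : (0 : ℝ) ≤ (1 / 2) ^ n := by positivity
        linarith
    _ = 4 * τ := mul_one _

/-! ### Expectations along a Markov chain -/

lemma integral_comp_eq_sum {Ω : Type*} [MeasurableSpace Ω] (ρ : Measure Ω) [IsFiniteMeasure ρ]
    {V : Type*} [Fintype V] [MeasurableSpace V] [MeasurableSingletonClass V] {Y : Ω → V}
    (hY : Measurable Y) (g : V → ℝ) :
    ∫ ω, g (Y ω) ∂ρ = ∑ v, ρ.real {ω | Y ω = v} * g v := by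
  rw [← integral_map hY.aemeasurable (Measurable.of_discrete (f := g)).aestronglyMeasurable,
    integral_fintype (Integrable.of_finite)]
  refine Finset.sum_congr rfl fun v _ => ?_
  rw [map_measureReal_apply hY (measurableSet_singleton v), smul_eq_mul]
  rfl

section Markov

variable {Ω : Type*} [MeasurableSpace Ω] {ρ : Measure Ω} [IsProbabilityMeasure ρ]
  {S : Type*} [Fintype S] [DecidableEq S] [MeasurableSpace S] [MeasurableSingletonClass S]
  {P : Matrix S S ℝ} {Z : ℕ → Ω → S}

-- Both integrands factor through finitely many states, so the claim is the cylinder identity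
-- `transition` summed over trajectories; no conditional expectation is needed.
omit [DecidableEq S] in
lemma IsMarkovChain.integral_succ (hZ : IsMarkovChain P Z ρ) (n : ℕ) {Ψ : (ℕ → S) → S → ℝ}
    (hΨ : ∀ y, DependsOn (fun x => Ψ x y) (Set.Iic n)) :
    ∫ ω, Ψ (fun i => Z i ω) (Z (n + 1) ω) ∂ρ
      = ∫ ω, ∑ y, P (Z n ω) y * Ψ (fun i => Z i ω) y ∂ρ := by
  let X : Ω → Fin (n + 1) → S := fun ω i => Z i ω
  -- A finite trajectory is continued by repeating its last state; `hΨ` makes the choice of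
  -- continuation irrelevant.
  let e : (Fin (n + 1) → S) → ℕ → S := fun u i => u ⟨min i n, by omega⟩
  have hX : Measurable X := measurable_pi_lambda _ fun i => hZ.measurable i
  have he : ∀ ω y, Ψ (fun i => Z i ω) y = Ψ (e (X ω)) y := fun ω y =>
    hΨ y fun i hi => by simp [e, X, Nat.min_eq_left (Set.mem_Iic.1 hi)]
  have hlast : ∀ ω, Z n ω = X ω (Fin.last n) := fun ω => rfl
  simp only [he, hlast]
  rw [integral_comp_eq_sum ρ (hX.prodMk (hZ.measurable (n + 1)))
      (fun v : (Fin (n + 1) → S) × S => Ψ (e v.1) v.2),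
    integral_comp_eq_sum ρ hX (fun u => ∑ y, P (u (Fin.last n)) y * Ψ (e u) y),
    Fintype.sum_prod_type]
  refine Finset.sum_congr rfl fun u _ => ?_
  rw [Finset.mul_sum]
  refine Finset.sum_congr rfl fun y _ => ?_
  rw [← mul_assoc]
  congr 1
  have htr := hZ.transition n fun i => if i ≤ n then e u i else y
  have h1 : {ω | (X ω, Z (n + 1) ω) = (u, y)}
      = {ω | ∀ i ≤ n + 1, Z i ω = if i ≤ n then e u i else y} := by
    ext ω
    simp only [Set.mem_ofPred_eq, Prod.mk.injEq]
    constructor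
    · rintro ⟨rfl, rfl⟩ i hi
      by_cases hin : i ≤ n
      · simp [hin, e, X]
      · obtain rfl : i = n + 1 := by omega
        simp
    · intro h
      refine ⟨funext fun i => ?_, by simpa using h (n + 1) le_rfl⟩
      have hi : (i : ℕ) ≤ n := by omega
      simpa [hi, e, X] using h i (by omega)
  have h2 : {ω | X ω = u} = {ω | ∀ i ≤ n, Z i ω = if i ≤ n then e u i else y} := by
    ext ω
    simp only [Set.mem_ofPred_eq]
    constructor
    · rintro rfl i hi
      simp [hi, e, X]
    · intro h
      refine funext fun i => ?_
      have hi : (i : ℕ) ≤ n := by omega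
      simpa [hi, e, X] using h i (by omega)
  rw [h1, h2, htr]
  simp [e, Fin.last]

lemma IsMarkovChain.integral_add (hZ : IsMarkovChain P Z ρ) (n m : ℕ) {Φ : (ℕ → S) → S → ℝ}
    (hΦ : ∀ y, DependsOn (fun x => Φ x y) (Set.Iic n)) :
    ∫ ω, Φ (fun i => Z i ω) (Z (n + m) ω) ∂ρ
      = ∫ ω, ∑ y, (P ^ m) (Z n ω) y * Φ (fun i => Z i ω) y ∂ρ := by
  induction m generalizing Φ with
  | zero => simp [Matrix.one_apply]
  | succ m ih =>
    rw [← add_assoc, hZ.integral_succ (n + m) fun y =>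
      (hΦ y).mono (Set.Iic_subset_Iic.2 (Nat.le_add_right n m))]
    -- One transition only averages the last argument, so the new integrand still depends on the
    -- past up to n and the induction hypothesis applies to it.
    rw [ih (Φ := fun x z => ∑ y, P z y * Φ x y) fun z x x' h =>
      Finset.sum_congr rfl fun y _ => congrArg (P z y * ·) (hΦ y h)]
    congr 1 with ω
    simp only [pow_succ, Matrix.mul_apply, Finset.mul_sum, Finset.sum_mul]
    rw [Finset.sum_comm]
    simp only [mul_assoc]

/-- If the `μ`-average of `Φ x ·` vanishes, then a sample taken `m` steps after the past on which
`Φ` depends makes its expectation small. -/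
lemma IsMarkovChain.abs_integral_le (hZ : IsMarkovChain P Z ρ) {μ : S → ℝ} {n m : ℕ} {c B : ℝ}
    (hc : RowBound (P ^ m - constRows μ) c) (hB : 0 ≤ B) {Φ : (ℕ → S) → S → ℝ}
    (hΦ : ∀ y, DependsOn (fun x => Φ x y) (Set.Iic n)) (hΦB : ∀ x y, |Φ x y| ≤ B)
    (hμ : ∀ x, ∑ y, μ y * Φ x y = 0) :
    |∫ ω, Φ (fun i => Z i ω) (Z (n + m) ω) ∂ρ| ≤ B * c := by
  rw [hZ.integral_add n m hΦ, ← Real.norm_eq_abs]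
  refine (norm_integral_le_of_norm_le_const (C := B * c) (ae_of_all _ fun ω => ?_)).trans_eq
    (by simp)
  rw [Real.norm_eq_abs]
  -- The vanishing μ-average lets P^m be replaced by its deviation from Π.
  have : ∑ y, (P ^ m) (Z n ω) y * Φ (fun i => Z i ω) y
      = ∑ y, (P ^ m - constRows μ) (Z n ω) y * Φ (fun i => Z i ω) y := by
    simp only [Matrix.sub_apply, sub_mul, Finset.sum_sub_distrib, constRows, Matrix.of_apply, hμ,
      sub_zero]
  rw [this]
  calc _ ≤ ∑ y, |(P ^ m - constRows μ) (Z n ω) y| * B := by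
        refine (Finset.abs_sum_le_sum_abs _ _).trans (Finset.sum_le_sum fun y _ => ?_)
        rw [abs_mul]
        exact mul_le_mul_of_nonneg_left (hΦB _ _) (abs_nonneg _)
    _ = B * ∑ y, |(P ^ m - constRows μ) (Z n ω) y| := by rw [← Finset.sum_mul, mul_comm]
    _ ≤ B * c := mul_le_mul_of_nonneg_left (hc _) hB

end Markov

/-! ### Bias and variance of batch gradients along the chain -/

/-- A function of finitely many coordinates in a finite set factors through a finite discrete space;
measurability and boundedness are then automatic. -/
lemma DependsOn.integrable_comp {Ω : Type*} [MeasurableSpace Ω] {ρ : Measure Ω}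
    [IsFiniteMeasure ρ] {S : Type*} [Finite S] [MeasurableSpace S] [MeasurableSingletonClass S]
    {Z : ℕ → Ω → S} (hZ : ∀ n, Measurable (Z n)) {n : ℕ} {x : (ℕ → S) → ℝ}
    (hx : DependsOn x (Set.Iic n)) : Integrable (fun ω => x fun i => Z i ω) ρ := by
  let X : Ω → Fin (n + 1) → S := fun ω i => Z i ω
  have hX : Measurable X := measurable_pi_lambda _ fun i => hZ i
  have h : (fun ω => x fun i => Z i ω)
      = (fun u : Fin (n + 1) → S => x fun i => u ⟨min i n, by omega⟩) ∘ X := by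
    ext ω
    exact hx fun i hi => by simp [X, Nat.min_eq_left (Set.mem_Iic.1 hi)]
  rw [h, ← integrable_map_measure (Measurable.of_discrete.aestronglyMeasurable) hX.aemeasurable]
  exact Integrable.of_finite

section Gradients

variable {S : Type*} [Fintype S] {d : ℕ} {f : EuclideanSpace ℝ (Fin d) → S → ℝ} {μ : S → ℝ}
  {G : ℝ}

lemma HasBoundedGradients.gradient_objective (hf : HasBoundedGradients f G) (μ : S → ℝ)
    (w : EuclideanSpace ℝ (Fin d)) :
    ∇ (objective f μ) w = ∑ y, μ y • ∇ (fun v => f v y) w := by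
  have h : HasFDerivAt (objective f μ) (∑ y, μ y • fderiv ℝ (fun v => f v y) w) w :=
    HasFDerivAt.fun_sum fun y _ => ((hf.differentiable y) w).hasFDerivAt.const_mul (μ y)
  rw [gradient, h.fderiv, map_sum]
  simp [gradient]

lemma HasBoundedGradients.norm_gradient_objective_le (hf : HasBoundedGradients f G)
    (hμ : μ ∈ stdSimplex ℝ S) (w : EuclideanSpace ℝ (Fin d)) : ‖∇ (objective f μ) w‖ ≤ G := by
  rw [hf.gradient_objective]
  calc _ ≤ ∑ y, μ y * G := by
        refine norm_sum_le_of_le _ fun y _ => ?_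
        rw [norm_smul, Real.norm_of_nonneg (hμ.1 y)]
        exact mul_le_mul_of_nonneg_left (hf.bound w y) (hμ.1 y)
    _ = G := by rw [← Finset.sum_mul, hμ.2, one_mul]

/-- The deviation of the gradient at the sample `y` from the gradient of the objective. -/
noncomputable def gradNoise (f : EuclideanSpace ℝ (Fin d) → S → ℝ) (μ : S → ℝ)
    (w : EuclideanSpace ℝ (Fin d)) (y : S) : EuclideanSpace ℝ (Fin d) :=
  ∇ (fun v => f v y) w - ∇ (objective f μ) w

lemma HasBoundedGradients.norm_gradNoise_le (hf : HasBoundedGradients f G)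
    (hμ : μ ∈ stdSimplex ℝ S) (w : EuclideanSpace ℝ (Fin d)) (y : S) :
    ‖gradNoise f μ w y‖ ≤ 2 * G :=
  (norm_sub_le _ _).trans (by
    linarith [hf.bound w y, hf.norm_gradient_objective_le hμ w])

lemma HasBoundedGradients.sum_inner_gradNoise (hf : HasBoundedGradients f G)
    (hμ : μ ∈ stdSimplex ℝ S) (a w : EuclideanSpace ℝ (Fin d)) :
    ∑ y, μ y * inner ℝ a (gradNoise f μ w y) = 0 := by
  have : ∑ y, μ y • gradNoise f μ w y = 0 := by
    simp only [gradNoise, smul_sub, Finset.sum_sub_distrib, ← Finset.sum_smul, hμ.2, one_smul]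
    rw [hf.gradient_objective μ w, sub_self]
  rw [← inner_zero_right (𝕜 := ℝ) a, ← this, inner_sum]
  simp [inner_smul_right]

lemma batchGrad_sub_gradient_objective (f : EuclideanSpace ℝ (Fin d) → S → ℝ) (μ : S → ℝ)
    (z : ℕ → S) (s : ℕ) (w : EuclideanSpace ℝ (Fin d)) (i : ℕ) :
    batchGrad f z s w i - ∇ (objective f μ) w
      = ((2 : ℝ) ^ i)⁻¹ • ∑ k ∈ Finset.range (2 ^ i), gradNoise f μ w (z (s + k)) := by
  simp only [batchGrad, gradNoise, Finset.sum_sub_distrib, smul_sub, Finset.sum_const,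
    Finset.card_range]
  rw [← Nat.cast_smul_eq_nsmul ℝ, Nat.cast_pow, Nat.cast_ofNat, inv_smul_smul₀ (by positivity)]

omit [Fintype S] in
lemma HasBoundedGradients.norm_batchGrad_le (hf : HasBoundedGradients f G)
    (z : ℕ → S) (s : ℕ) (w : EuclideanSpace ℝ (Fin d)) (i : ℕ) : ‖batchGrad f z s w i‖ ≤ G := by
  rw [batchGrad, norm_smul, norm_inv, norm_pow, Real.norm_ofNat, inv_mul_le_iff₀ (by positivity)]
  refine (norm_sum_le_of_le _ fun k _ => hf.bound w (z (s + k))).trans_eq ?_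
  simp

variable [DecidableEq S] [MeasurableSpace S] [MeasurableSingletonClass S]
  {Ω : Type*} [MeasurableSpace Ω] {ρ : Measure Ω} [IsProbabilityMeasure ρ]
  {P : Matrix S S ℝ} {Z : ℕ → Ω → S}

omit [Fintype S] [DecidableEq S] [MeasurableSpace S] [MeasurableSingletonClass S] in
lemma DependsOn.comp_apply {α β : Type*} {w : (ℕ → S) → α} {s n : ℕ}
    (hw : DependsOn w (Set.Iic s)) (hs : s ≤ n) (g : α → S → β) :
    DependsOn (fun z => g (w z) (z n)) (Set.Iic n) := fun x x' h => by
  change g (w x) (x n) = g (w x') (x' n)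
  rw [h n Set.self_mem_Iic, hw.mono (Set.Iic_subset_Iic.2 hs) h]

/-- Past vectors are nearly uncorrelated with the noise of later samples. -/
lemma IsMarkovChain.abs_integral_inner_gradNoise_le (hZ : IsMarkovChain P Z ρ)
    (hP : P ∈ Matrix.rowStochastic ℝ S) (hE : IsErgodicMatrix P)
    (hμ : IsStationaryDistribution P μ) (hf : HasBoundedGradients f G) (hG : 0 ≤ G)
    {w A : (ℕ → S) → EuclideanSpace ℝ (Fin d)} {n m : ℕ} {B : ℝ} (hB : 0 ≤ B)
    (hw : DependsOn w (Set.Iic n)) (hA : DependsOn A (Set.Iic n)) (hAB : ∀ z, ‖A z‖ ≤ B) :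
    |∫ ω, inner ℝ (A fun i => Z i ω)
        (gradNoise f μ (w fun i => Z i ω) (Z (n + m) ω)) ∂ρ|
      ≤ B * (2 * G) * (2 * (1 / 2) ^ (m / mixingTime P μ)) := by
  refine hZ.abs_integral_le (Φ := fun z y => inner ℝ (A z) (gradNoise f μ (w z) y))
    (rowBound_pow_sub_constRows hP hE hμ m) (by positivity) ?_ ?_ ?_
  · intro y x x' h
    change inner ℝ (A x) (gradNoise f μ (w x) y) = inner ℝ (A x') (gradNoise f μ (w x') y)
    rw [hA h, hw h]
  · intro x y
    exact (abs_real_inner_le_norm _ _).trans (mul_le_mul (hAB x)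
      (hf.norm_gradNoise_le hμ.mem_stdSimplex _ _) (norm_nonneg _) hB)
  · exact fun x => hf.sum_inner_gradNoise hμ.mem_stdSimplex _ _

/-- The gradient at w is a past vector for every sample of the batch, and the decaying correlations
sum to O(τ). The past may include sample s itself: the term k = 0 then only gets the trivial bound,
which does not affect the order. -/
lemma IsMarkovChain.abs_integral_inner_batchGrad_sub_le (hZ : IsMarkovChain P Z ρ)
    (hP : P ∈ Matrix.rowStochastic ℝ S) (hE : IsErgodicMatrix P)
    (hμ : IsStationaryDistribution P μ) (hf : HasBoundedGradients f G) (hG : 0 ≤ G)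
    {w : (ℕ → S) → EuclideanSpace ℝ (Fin d)} {s : ℕ} (hw : DependsOn w (Set.Iic s)) (i : ℕ) :
    |∫ ω, inner ℝ (∇ (objective f μ) (w fun i => Z i ω))
        (batchGrad f (fun i => Z i ω) s (w fun i => Z i ω) i
          - ∇ (objective f μ) (w fun i => Z i ω)) ∂ρ|
      ≤ 8 * mixingTime P μ * G ^ 2 / 2 ^ i := by
  simp only [batchGrad_sub_gradient_objective, inner_smul_right, inner_sum]
  have hint : ∀ k ∈ Finset.range (2 ^ i), Integrable (fun ω =>
      inner ℝ (∇ (objective f μ) (w fun i => Z i ω))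
        (gradNoise f μ (w fun i => Z i ω) (Z (s + k) ω))) ρ := fun k _ =>
    (hw.comp_apply (Nat.le_add_right s k)
      fun a y => inner ℝ (∇ (objective f μ) a) (gradNoise f μ a y)).integrable_comp hZ.measurable
  rw [integral_const_mul, integral_finsetSum _ hint, abs_mul, abs_of_nonneg (by positivity),
    div_eq_inv_mul]
  refine mul_le_mul_of_nonneg_left ?_ (by positivity)
  calc _ ≤ ∑ k ∈ Finset.range (2 ^ i),
        G * (2 * G) * (2 * (1 / 2 : ℝ) ^ (k / mixingTime P μ)) := by
        refine (Finset.abs_sum_le_sum_abs _ _).trans (Finset.sum_le_sum fun k _ => ?_)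
        refine hZ.abs_integral_inner_gradNoise_le hP hE hμ hf hG hG hw
          (A := fun z => ∇ (objective f μ) (w z)) (fun x x' h => ?_)
          (fun z => hf.norm_gradient_objective_le hμ.mem_stdSimplex _)
        exact congrArg _ (hw h)
    _ ≤ G * (2 * G) * (4 * mixingTime P μ) := by
        rw [← Finset.mul_sum]
        exact mul_le_mul_of_nonneg_left (sum_half_pow_div_le (mixingTime_spec hP hE hμ).1 _)
          (by positivity)
    _ = 8 * mixingTime P μ * G ^ 2 := by ring

lemma sum_dist_le {r : ℕ → ℝ} (hr : ∀ n, 0 ≤ r n) {R : ℝ}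
    (hR : ∀ n, ∑ m ∈ Finset.range n, r m ≤ R) {k n : ℕ} (hk : k ≤ n) :
    ∑ l ∈ Finset.range n, r (Nat.dist k l) ≤ 2 * R := by
  obtain ⟨m, rfl⟩ := Nat.exists_eq_add_of_le hk
  rw [Finset.sum_range_add]
  -- To the left of k the distances are 1, …, k; comparing with a sum over `range (k + 1)` drops the
  -- term r 0.
  have h1 : ∑ l ∈ Finset.range k, r (Nat.dist k l) ≤ R := by
    refine le_trans ?_ (hR (k + 1))
    rw [← Finset.sum_range_reflect, Finset.sum_range_succ']
    refine le_trans (le_of_eq ?_) (le_add_of_nonneg_right (hr 0))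
    refine Finset.sum_congr rfl fun j hj => ?_
    have := Finset.mem_range.1 hj
    rw [Nat.dist_eq_sub_of_le_right (by omega), show k - (k - 1 - j) = j + 1 by omega]
  have h2 : ∑ l ∈ Finset.range m, r (Nat.dist k (k + l)) ≤ R := by
    refine le_trans (le_of_eq ?_) (hR m)
    refine Finset.sum_congr rfl fun j _ => ?_
    rw [Nat.dist_eq_sub_of_le (by omega), Nat.add_sub_cancel_left]
  linarith

/-- Expanding the square leaves covariances of noise terms. In each, the earlier term plays the past
vector, so the covariance decays with the distance of the two samples. Every row of the covariance
array sums to O(τG²), and there are 2^i rows against the normalization 4^{-i}. -/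
lemma IsMarkovChain.integral_norm_batchGrad_sub_sq_le (hZ : IsMarkovChain P Z ρ)
    (hP : P ∈ Matrix.rowStochastic ℝ S) (hE : IsErgodicMatrix P)
    (hμ : IsStationaryDistribution P μ) (hf : HasBoundedGradients f G) (hG : 0 ≤ G)
    {w : (ℕ → S) → EuclideanSpace ℝ (Fin d)} {s : ℕ} (hw : DependsOn w (Set.Iic s)) (i : ℕ) :
    ∫ ω, ‖batchGrad f (fun i => Z i ω) s (w fun i => Z i ω) i
          - ∇ (objective f μ) (w fun i => Z i ω)‖ ^ 2 ∂ρ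
      ≤ 32 * mixingTime P μ * G ^ 2 / 2 ^ i := by
  set r : ℕ → ℝ := fun m => 2 * (1 / 2 : ℝ) ^ (m / mixingTime P μ) with hr
  have hcov : ∀ k l : ℕ, k ≤ l → |∫ ω, inner ℝ
      (gradNoise f μ (w fun i => Z i ω) (Z (s + k) ω))
      (gradNoise f μ (w fun i => Z i ω) (Z (s + l) ω)) ∂ρ| ≤ 2 * G * (2 * G) * r (l - k) := by
    intro k l hkl
    have := hZ.abs_integral_inner_gradNoise_le hP hE hμ hf hG (m := l - k)
      (show 0 ≤ 2 * G by positivity)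
      (hw.mono (Set.Iic_subset_Iic.2 (Nat.le_add_right s k)))
      (hw.comp_apply (Nat.le_add_right s k) (gradNoise f μ))
      (fun z => hf.norm_gradNoise_le hμ.mem_stdSimplex _ _)
    rwa [show s + k + (l - k) = s + l by omega] at this
  have hcov' : ∀ k l : ℕ, |∫ ω, inner ℝ
      (gradNoise f μ (w fun i => Z i ω) (Z (s + k) ω))
      (gradNoise f μ (w fun i => Z i ω) (Z (s + l) ω)) ∂ρ|
      ≤ 2 * G * (2 * G) * r (Nat.dist k l) := by
    intro k l
    rcases le_total k l with h | h
    · rw [Nat.dist_eq_sub_of_le h]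
      exact hcov k l h
    · rw [Nat.dist_eq_sub_of_le_right h]
      simpa only [real_inner_comm] using hcov l k h
  have hint : ∀ k l : ℕ, Integrable (fun ω => (inner ℝ
      (gradNoise f μ (w fun i => Z i ω) (Z (s + k) ω))
      (gradNoise f μ (w fun i => Z i ω) (Z (s + l) ω)) : ℝ)) ρ := by
    intro k l
    have hd : DependsOn (fun z : ℕ → S =>
        (inner ℝ (gradNoise f μ (w z) (z (s + k))) (gradNoise f μ (w z) (z (s + l))) : ℝ))
        (Set.Iic (s + k + l)) := fun x x' h => by
      change inner ℝ (gradNoise f μ (w x) (x (s + k))) (gradNoise f μ (w x) (x (s + l)))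
        = inner ℝ (gradNoise f μ (w x') (x' (s + k))) (gradNoise f μ (w x') (x' (s + l)))
      rw [h (s + k) (Set.mem_Iic.2 (by omega)), h (s + l) (Set.mem_Iic.2 (by omega)),
        hw.mono (Set.Iic_subset_Iic.2 (by omega)) h]
    exact hd.integrable_comp hZ.measurable
  have hsq : ∀ ω, ‖batchGrad f (fun i => Z i ω) s (w fun i => Z i ω) i
        - ∇ (objective f μ) (w fun i => Z i ω)‖ ^ 2
      = ((2 : ℝ) ^ i)⁻¹ ^ 2 * ∑ k ∈ Finset.range (2 ^ i), ∑ l ∈ Finset.range (2 ^ i), inner ℝ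
        (gradNoise f μ (w fun i => Z i ω) (Z (s + k) ω))
        (gradNoise f μ (w fun i => Z i ω) (Z (s + l) ω)) := fun ω => by
    rw [batchGrad_sub_gradient_objective, norm_smul, mul_pow, Real.norm_of_nonneg (by positivity),
      ← real_inner_self_eq_norm_sq, sum_inner]
    simp only [inner_sum]
  simp only [hsq]
  rw [integral_const_mul, integral_finsetSum _ fun k _ => integrable_finsetSum _ fun l _ =>
    hint k l]
  have hsum : ∀ k ∈ Finset.range (2 ^ i), ∫ ω, ∑ l ∈ Finset.range (2 ^ i), inner ℝ
        (gradNoise f μ (w fun i => Z i ω) (Z (s + k) ω))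
        (gradNoise f μ (w fun i => Z i ω) (Z (s + l) ω)) ∂ρ
      ≤ 2 * G * (2 * G) * (2 * (4 * mixingTime P μ)) := by
    intro k hk
    rw [integral_finsetSum _ fun l _ => hint k l]
    calc _ ≤ ∑ l ∈ Finset.range (2 ^ i), 2 * G * (2 * G) * r (Nat.dist k l) :=
          Finset.sum_le_sum fun l _ => (le_abs_self _).trans (hcov' k l)
      _ ≤ _ := by
          rw [← Finset.mul_sum]
          refine mul_le_mul_of_nonneg_left (sum_dist_le (fun n => by positivity)
            (sum_half_pow_div_le (mixingTime_spec hP hE hμ).1) (Finset.mem_range.1 hk).le)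
            (by positivity)
  calc _ ≤ ((2 : ℝ) ^ i)⁻¹ ^ 2 * ∑ k ∈ Finset.range (2 ^ i),
        2 * G * (2 * G) * (2 * (4 * mixingTime P μ)) :=
        mul_le_mul_of_nonneg_left (Finset.sum_le_sum hsum) (by positivity)
    _ = _ := by
        rw [Finset.sum_const, Finset.card_range, nsmul_eq_mul]
        push_cast
        field_simp
        ring

end Gradients

/-! ### The deterministic regret bound of normalized adaptive steps -/

section Descent

variable {d : ℕ} {F : EuclideanSpace ℝ (Fin d) → ℝ} {L : ℝ}

/-- The mean value inequality on a ball yields the constant L instead of L/2, which only affects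
absolute constants. -/
lemma IsLSmooth.le_add_inner_add (hF : IsLSmooth F L) (hL : 0 ≤ L)
    (x y : EuclideanSpace ℝ (Fin d)) :
    F y ≤ F x + inner ℝ (∇ F x) (y - x) + L * ‖y - x‖ ^ 2 := by
  have hb : ∀ u ∈ Metric.closedBall x ‖y - x‖,
      ‖fderiv ℝ F u - fderiv ℝ F x‖ ≤ L * ‖y - x‖ := by
    intro u hu
    rw [← toDual_gradient, ← toDual_gradient, ← map_sub, LinearIsometryEquiv.norm_map]
    refine (hF.lipschitz u x).trans (mul_le_mul_of_nonneg_left ?_ hL)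
    rwa [mem_closedBall_iff_norm] at hu
  have := (convex_closedBall x ‖y - x‖).norm_image_sub_le_of_norm_fderiv_le'
    (fun u _ => hF.differentiable u) hb (Metric.mem_closedBall_self (norm_nonneg _))
    (show y ∈ Metric.closedBall x ‖y - x‖ by rw [mem_closedBall_iff_norm])
  rw [← inner_gradient_left, Real.norm_eq_abs] at this
  nlinarith [le_abs_self (F y - F x - inner ℝ (∇ F x) (y - x))]

lemma IsLSmooth.sum_inner_le {M : ℝ} (hF : IsLSmooth F L) (hL : 0 ≤ L) (hM : ∀ w, |F w| ≤ M)
    {w g : ℕ → EuclideanSpace ℝ (Fin d)} {v : ℕ → ℝ} (hv0 : v 0 = 0)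
    (hv : ∀ t, v (t + 1) = v t + ‖g t‖ ^ 2)
    (hw : ∀ t, w (t + 1) = w t - (1 / √(v (t + 1))) • g t) (n : ℕ) :
    ∑ t ∈ Finset.range n, inner ℝ (∇ F (w t)) (g t) ≤ (2 * M + 2 * L) * √(v n) := by
  have hnn : ∀ t, 0 ≤ v t := fun t => by
    induction t with
    | zero => exact hv0.ge
    | succ t ih => rw [hv]; positivity
  -- After multiplication by √v_{t+1}, the factor of M - F(w_t) ≥ 0 may be lowered to √v_t in the
  -- subtracted term, so that it telescopes. The quadratic term telescopes through ‖g_t‖² = v_{t+1}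
  -- - v_t ≤ 2√v_{t+1}(√v_{t+1} - √v_t).
  have step : ∀ t, inner ℝ (∇ F (w t)) (g t)
      ≤ √(v (t + 1)) * (M - F (w (t + 1))) - √(v t) * (M - F (w t))
        + 2 * L * (√(v (t + 1)) - √(v t)) := by
    intro t
    set s := √(v (t + 1)) with hs
    set s' := √(v t) with hs'
    have hss : s' ≤ s := Real.sqrt_le_sqrt (by rw [hv]; linarith [sq_nonneg ‖g t‖])
    have hs'0 : 0 ≤ s' := Real.sqrt_nonneg _
    have hg : ‖g t‖ ^ 2 = s ^ 2 - s' ^ 2 := by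
      rw [hs, hs', Real.sq_sqrt (hnn _), Real.sq_sqrt (hnn _), hv]
      ring
    have hMF : 0 ≤ M - F (w t) := by linarith [le_abs_self (F (w t)), hM (w t)]
    -- If all estimators so far vanish, the step is undefined on paper and is 0 here by division by
    -- zero; both sides are then 0.
    rcases (hs'0.trans hss).eq_or_lt with h0 | hpos
    · have hs0 : s' = 0 := le_antisymm (by rw [h0]; exact hss) hs'0
      have hg0 : g t = 0 := by
        rw [← h0, hs0] at hg
        simpa using hg
      rw [hg0, ← h0, hs0]
      simp
    · have hd := hF.le_add_inner_add hL (w t) (w (t + 1))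
      have hsub : w (t + 1) - w t = -((1 / s) • g t) := by rw [hw]; abel
      rw [hsub, inner_neg_right, inner_smul_right, norm_neg, norm_smul, mul_pow,
        Real.norm_of_nonneg (by positivity), hg] at hd
      have h1 : s * F (w (t + 1)) ≤ s * F (w t) - inner ℝ (∇ F (w t)) (g t)
          + L * ((s ^ 2 - s' ^ 2) / s) := by
        have := mul_le_mul_of_nonneg_left hd hpos.le
        refine this.trans_eq ?_
        field_simp
        ring
      have h2 : (s ^ 2 - s' ^ 2) / s ≤ 2 * (s - s') := by
        rw [div_le_iff₀ hpos]
        nlinarith [mul_nonneg (sub_nonneg.2 hss) (sub_nonneg.2 hss)]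
      have h3 := mul_le_mul_of_nonneg_left h2 hL
      have h4 := mul_nonneg (sub_nonneg.2 hss) hMF
      linarith
  have htot : ∑ t ∈ Finset.range n, inner ℝ (∇ F (w t)) (g t)
      ≤ √(v n) * (M - F (w n)) + 2 * L * √(v n) := by
    refine (Finset.sum_le_sum fun t _ => step t).trans_eq ?_
    rw [Finset.sum_add_distrib, ← Finset.mul_sum,
      Finset.sum_range_sub (fun t => √(v t) * (M - F (w t))),
      Finset.sum_range_sub (fun t => √(v t)), hv0]
    simp
  have h5 : M - F (w n) ≤ 2 * M := by linarith [neg_abs_le (F (w n)), hM (w n)]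
  have h6 := mul_le_mul_of_nonneg_left h5 (Real.sqrt_nonneg (v n))
  linarith

end Descent

/-! ### Measurability and locality of the run of the algorithm -/

section Run

variable {S : Type*} {d : ℕ} {f : EuclideanSpace ℝ (Fin d) → S → ℝ} {α : ℝ} {T : ℕ} {N : ℕ → ℕ}
  {w₁ : EuclideanSpace ℝ (Fin d)}

lemma magState_used (z : ℕ → S) (j : ℕ → ℕ) (t : ℕ) :
    (magState f α T N w₁ z j t).used = ∑ k ∈ Finset.range t, N (j k) := by
  induction t with
  | zero => rfl
  | succ t ih => rw [Finset.sum_range_succ, ← ih]; rfl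

lemma batchGrad_congr {z z' : ℕ → S} {s n : ℕ} (h : ∀ i < s + n, z i = z' i)
    (w : EuclideanSpace ℝ (Fin d)) {i : ℕ} (hi : 2 ^ i ≤ n) :
    batchGrad f z s w i = batchGrad f z' s w i := by
  unfold batchGrad
  congr 1
  refine Finset.sum_congr rfl fun k hk => ?_
  rw [h (s + k) (by have := Finset.mem_range.1 hk; omega)]

lemma IsSampleCount.mlmcGrad_congr (hN : IsSampleCount T N) {z z' : ℕ → S} {s i : ℕ}
    (h : ∀ k < s + N i, z k = z' k) (w : EuclideanSpace ℝ (Fin d)) :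
    mlmcGrad f T z s w i = mlmcGrad f T z' s w i := by
  unfold mlmcGrad
  rw [batchGrad_congr h w (i := 0) (hN.pos i)]
  split_ifs with hi
  · rw [batchGrad_congr h w (hN.eq_two_pow i hi).ge,
      batchGrad_congr h w (i := i - 1) ((Nat.pow_le_pow_right two_pos (Nat.sub_le i 1)).trans
        (hN.eq_two_pow i hi).ge)]
  · rfl

/-- The state after `t` iterations is a function of the consumed samples. -/
lemma IsSampleCount.magState_congr (hN : IsSampleCount T N) {z z' : ℕ → S} (j : ℕ → ℕ) (t : ℕ)
    (h : ∀ i < ∑ k ∈ Finset.range t, N (j k), z i = z' i) :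
    magState f α T N w₁ z j t = magState f α T N w₁ z' j t := by
  induction t with
  | zero => rfl
  | succ t ih =>
    rw [Finset.sum_range_succ] at h
    have ih' := ih fun i hi => h i (by omega)
    simp only [magState, magStep]
    rw [ih', hN.mlmcGrad_congr (by rw [magState_used]; exact h)]

lemma magState_levels_congr (z : ℕ → S) {j j' : ℕ → ℕ} (t : ℕ) (h : ∀ k < t, j k = j' k) :
    magState f α T N w₁ z j t = magState f α T N w₁ z j' t := by
  induction t with
  | zero => rfl
  | succ t ih =>
    simp only [magState]
    rw [ih fun k hk => h k (by omega), h t (Nat.lt_succ_self t)]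

/-- The level-`i` average of gradients that is available in iteration `t`. -/
noncomputable def levelGrad (f : EuclideanSpace ℝ (Fin d) → S → ℝ) (α : ℝ) (T : ℕ) (N : ℕ → ℕ)
    (w₁ : EuclideanSpace ℝ (Fin d)) (t i : ℕ) (j : ℕ → ℕ) (z : ℕ → S) :
    EuclideanSpace ℝ (Fin d) :=
  batchGrad f z (magState f α T N w₁ z j t).used (magState f α T N w₁ z j t).point i

/-- The gradient estimator of iteration `t`. -/
noncomputable def stepGrad (f : EuclideanSpace ℝ (Fin d) → S → ℝ) (α : ℝ) (T : ℕ) (N : ℕ → ℕ)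
    (w₁ : EuclideanSpace ℝ (Fin d)) (t : ℕ) (j : ℕ → ℕ) (z : ℕ → S) :
    EuclideanSpace ℝ (Fin d) :=
  mlmcGrad f T z (magState f α T N w₁ z j t).used (magState f α T N w₁ z j t).point (j t)

lemma stepGrad_eq_sum (hT : 1 ≤ T) (t : ℕ) (j : ℕ → ℕ) (z : ℕ → S) :
    stepGrad f α T N w₁ t j z = levelGrad f α T N w₁ t 0 j z
      + ∑ i ∈ Finset.range (Nat.log 2 T), if j t = i + 1 then (2 : ℝ) ^ (i + 1) •
          (levelGrad f α T N w₁ t (i + 1) j z - levelGrad f α T N w₁ t i j z) else 0 := by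
  unfold stepGrad mlmcGrad levelGrad
  congr 1
  have hlog : 2 ^ j t ≤ T ↔ j t ≤ Nat.log 2 T :=
    (Nat.le_log_iff_pow_le (by norm_num) (by omega)).symm
  rcases Nat.eq_zero_or_pos (j t) with h0 | hpos
  -- Level 0 has probability zero but is not excluded pointwise; its correction vanishes because 0 -
  -- 1 = 0 in ℕ.
  · rw [Finset.sum_eq_zero fun i _ => if_neg (by omega)]
    simp [h0]
  · obtain ⟨n, hn⟩ := Nat.exists_eq_add_of_le' hpos
    rw [hn] at hlog
    simp only [hn, Nat.succ_eq_add_one, zero_add] at hlog ⊢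
    simp only [hlog]
    split_ifs with hle
    · rw [Finset.sum_eq_single_of_mem n (Finset.mem_range.2 (by omega))
        fun i _ hi => if_neg (by omega), if_pos rfl]
      rfl
    · rw [Finset.sum_eq_zero fun i hi => if_neg (by have := Finset.mem_range.1 hi; omega)]

/-- At most one level is active, so no cross terms between levels occur. The free centre a will be
the true gradient, turning differences of batch averages into two mean square errors. -/
lemma norm_stepGrad_sq_le (hT : 1 ≤ T) (t : ℕ) (j : ℕ → ℕ) (z : ℕ → S)
    (a : EuclideanSpace ℝ (Fin d)) :
    ‖stepGrad f α T N w₁ t j z‖ ^ 2 ≤ 2 * ‖levelGrad f α T N w₁ t 0 j z‖ ^ 2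
      + ∑ i ∈ Finset.range (Nat.log 2 T), (4 : ℝ) ^ (i + 2) * ((if j t = i + 1 then 1 else 0) *
          (‖levelGrad f α T N w₁ t (i + 1) j z - a‖ ^ 2
            + ‖levelGrad f α T N w₁ t i j z - a‖ ^ 2)) := by
  have hsq : ∀ x y : EuclideanSpace ℝ (Fin d), ‖x + y‖ ^ 2 ≤ 2 * ‖x‖ ^ 2 + 2 * ‖y‖ ^ 2 :=
    fun x y => by
      have := pow_le_pow_left₀ (norm_nonneg _) (norm_add_le x y) 2
      nlinarith [sq_nonneg (‖x‖ - ‖y‖)]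
  rw [stepGrad_eq_sum hT]
  refine (hsq _ _).trans (add_le_add le_rfl ?_)
  have hterm : ∀ i, 0 ≤ (4 : ℝ) ^ (i + 2) * ((if j t = i + 1 then 1 else 0) *
      (‖levelGrad f α T N w₁ t (i + 1) j z - a‖ ^ 2
        + ‖levelGrad f α T N w₁ t i j z - a‖ ^ 2)) := fun i => by
    split_ifs <;> positivity
  by_cases h : ∃ n ∈ Finset.range (Nat.log 2 T), j t = n + 1
  · obtain ⟨n, hn, hjn⟩ := h
    refine le_trans ?_ (Finset.single_le_sum (fun i _ => hterm i) hn)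
    rw [Finset.sum_eq_single_of_mem n hn fun i _ hi => if_neg (by omega), if_pos hjn, if_pos hjn,
      norm_smul, mul_pow, norm_pow, Real.norm_ofNat, one_mul]
    have h1 := hsq (levelGrad f α T N w₁ t (n + 1) j z - a)
      (-(levelGrad f α T N w₁ t n j z - a))
    rw [norm_neg, ← sub_eq_add_neg, sub_sub_sub_cancel_right] at h1
    have h2 := mul_le_mul_of_nonneg_left h1 (show 0 ≤ 2 * ((2 : ℝ) ^ (n + 1)) ^ 2 by positivity)
    -- The extra factor 4 is one 2 for splitting off the single-sample gradient and one 2 for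
    -- centring at a.
    have h3 : (4 : ℝ) ^ (n + 2) = 4 * (2 ^ (n + 1)) ^ 2 := by
      rw [← pow_mul, mul_comm (n + 1) 2, pow_mul]
      norm_num
      ring
    rw [h3]
    linarith
  · push Not at h
    rw [Finset.sum_eq_zero fun i hi => if_neg (h i hi)]
    simpa using Finset.sum_nonneg fun i _ => hterm i

/-- This crude bound of order TG serves integrability only; it does not enter the rate. -/
lemma HasBoundedGradients.norm_stepGrad_le {G : ℝ} (hf : HasBoundedGradients f G) (hG : 0 ≤ G)
    (t : ℕ) (j : ℕ → ℕ) (z : ℕ → S) : ‖stepGrad f α T N w₁ t j z‖ ≤ G + T * (2 * G) := by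
  unfold stepGrad mlmcGrad
  refine (norm_add_le _ _).trans (add_le_add (hf.norm_batchGrad_le _ _ _ _) ?_)
  split_ifs with h
  · rw [norm_smul, norm_pow, Real.norm_ofNat]
    refine mul_le_mul (by exact_mod_cast h) ((norm_sub_le _ _).trans ?_) (norm_nonneg _)
      (Nat.cast_nonneg _)
    linarith [hf.norm_batchGrad_le z (magState f α T N w₁ z j t).used
      (magState f α T N w₁ z j t).point (j t), hf.norm_batchGrad_le z
      (magState f α T N w₁ z j t).used (magState f α T N w₁ z j t).point (j t - 1)]
  · rw [norm_zero]
    positivity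

variable [Finite S] [MeasurableSpace S] [MeasurableSingletonClass S]

/-- Positions, levels and sample values are countable, so joint measurability reduces to that of the
gradient of each single loss. -/
lemma measurable_batchGrad : Measurable fun q : (ℕ × ℕ) × (ℕ → S) × EuclideanSpace ℝ (Fin d) =>
    batchGrad f q.2.1 q.1.1 q.2.2 q.1.2 := by
  refine measurable_from_prod_countable_right fun si => ?_
  have hgrad : Measurable fun p : S × EuclideanSpace ℝ (Fin d) => ∇ (fun v => f v p.1) p.2 :=
    measurable_from_prod_countable_right fun y =>
      (InnerProductSpace.toDual ℝ (EuclideanSpace ℝ (Fin d))).symm.continuous.measurable.comp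
        (measurable_fderiv ℝ fun v => f v y)
  have hsum : Measurable fun p : (ℕ → S) × EuclideanSpace ℝ (Fin d) =>
      ∑ k ∈ Finset.range (2 ^ si.2), ∇ (fun v => f v (p.1 (si.1 + k))) p.2 :=
    Finset.measurable_fun_sum _ fun k _ => by
      have hk : Measurable fun p : (ℕ → S) × EuclideanSpace ℝ (Fin d) => (p.1 (si.1 + k), p.2) :=
        ((measurable_pi_apply (si.1 + k)).comp measurable_fst).prodMk measurable_snd
      exact hgrad.comp hk
  exact hsum.const_smul (((2 : ℝ) ^ si.2)⁻¹)

lemma measurable_mlmcGrad : Measurable fun q : (ℕ × ℕ) × (ℕ → S) × EuclideanSpace ℝ (Fin d) =>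
    mlmcGrad f T q.2.1 q.1.1 q.2.2 q.1.2 := by
  refine measurable_from_prod_countable_right fun si => ?_
  have hb : ∀ i : ℕ, Measurable fun p : (ℕ → S) × EuclideanSpace ℝ (Fin d) =>
      batchGrad f p.1 si.1 p.2 i := fun i =>
    measurable_batchGrad.comp (measurable_prodMk_left (x := (si.1, i)))
  unfold mlmcGrad
  refine (hb 0).add ?_
  by_cases h : 2 ^ si.2 ≤ T
  · simp only [h, if_true]
    exact ((hb si.2).sub (hb (si.2 - 1))).const_smul ((2 : ℝ) ^ si.2)
  · simp only [h, if_false]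
    exact measurable_const

omit [Finite S] [MeasurableSingletonClass S] in
lemma measurable_magState_used (t : ℕ) : Measurable fun q : (ℕ → ℕ) × (ℕ → S) =>
    (magState f α T N w₁ q.2 q.1 t).used := by
  simp only [magState_used]
  exact Finset.measurable_fun_sum _ fun k _ => Measurable.of_discrete.comp
    ((measurable_pi_apply k).comp measurable_fst)

lemma measurable_stepGrad_of_point {t : ℕ} (h : Measurable fun q : (ℕ → ℕ) × (ℕ → S) =>
    (magState f α T N w₁ q.2 q.1 t).point) :
    Measurable fun q : (ℕ → ℕ) × (ℕ → S) => stepGrad f α T N w₁ t q.1 q.2 := by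
  have h2 : Measurable fun q : (ℕ → ℕ) × (ℕ → S) =>
      (((magState f α T N w₁ q.2 q.1 t).used, q.1 t),
        (q.2, (magState f α T N w₁ q.2 q.1 t).point)) :=
    ((measurable_magState_used t).prodMk
      ((measurable_pi_apply t).comp measurable_fst)).prodMk (measurable_snd.prodMk h)
  have h3 := (measurable_mlmcGrad (f := f) (T := T)).comp h2
  simp only [Function.comp_def] at h3
  unfold stepGrad
  exact h3

lemma measurable_magState (t : ℕ) :
    (Measurable fun q : (ℕ → ℕ) × (ℕ → S) => (magState f α T N w₁ q.2 q.1 t).point) ∧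
      Measurable fun q : (ℕ → ℕ) × (ℕ → S) => (magState f α T N w₁ q.2 q.1 t).sumSq := by
  induction t with
  | zero => exact ⟨measurable_const, measurable_const⟩
  -- The point and the sum of squares go through the induction together because the step size uses
  -- the latter.
  | succ t ih =>
    have hg := measurable_stepGrad_of_point ih.1
    have hv : Measurable fun q : (ℕ → ℕ) × (ℕ → S) =>
        (magState f α T N w₁ q.2 q.1 t).sumSq + ‖stepGrad f α T N w₁ t q.1 q.2‖ ^ 2 :=
      ih.2.add (hg.norm.pow_const 2)
    exact ⟨ih.1.sub ((measurable_const.div hv.sqrt).smul hg), hv⟩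

lemma measurable_magIterate (t : ℕ) : Measurable fun q : (ℕ → ℕ) × (ℕ → S) =>
    magIterate f α T N w₁ q.2 q.1 t :=
  (measurable_magState t).1

lemma measurable_stepGrad (t : ℕ) :
    Measurable fun q : (ℕ → ℕ) × (ℕ → S) => stepGrad f α T N w₁ t q.1 q.2 :=
  measurable_stepGrad_of_point (measurable_magState t).1

lemma measurable_levelGrad (t i : ℕ) :
    Measurable fun q : (ℕ → ℕ) × (ℕ → S) => levelGrad f α T N w₁ t i q.1 q.2 := by
  have h2 : Measurable fun q : (ℕ → ℕ) × (ℕ → S) =>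
      (((magState f α T N w₁ q.2 q.1 t).used, i),
        (q.2, (magState f α T N w₁ q.2 q.1 t).point)) :=
    ((measurable_magState_used t).prodMk
      measurable_const).prodMk (measurable_snd.prodMk (measurable_magState t).1)
  have h3 := (measurable_batchGrad (f := f)).comp h2
  simp only [Function.comp_def] at h3
  unfold levelGrad
  exact h3

lemma IsLSmooth.measurable_gradient {F : EuclideanSpace ℝ (Fin d) → ℝ} {L : ℝ}
    (hF : IsLSmooth F L) (hL : 0 ≤ L) : Measurable (∇ F) :=
  (LipschitzWith.of_dist_le_mul (K := ⟨L, hL⟩) fun x y => by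
    rw [dist_eq_norm, dist_eq_norm]
    exact hF.lipschitz x y).continuous.measurable

end Run

/-! ### Expectations over the levels and the data -/

section Randomness

variable {Ω : Type*} [MeasurableSpace Ω] {ρ : Measure Ω} [IsProbabilityMeasure ρ]
  {S : Type*} [MeasurableSpace S] {T : ℕ} {Z : ℕ → Ω → S} {J : ℕ → Ω → ℕ} {I : Ω → Fin T}

lemma integrable_comp_of_abs_le {V : Type*} [MeasurableSpace V] {Y : Ω → V} (hY : Measurable Y)
    {X : V → ℝ} (hX : Measurable X) {B : ℝ} (hB : ∀ v, |X v| ≤ B) :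
    Integrable (fun ω => X (Y ω)) ρ :=
  Integrable.of_bound (hX.comp hY).aestronglyMeasurable B (ae_of_all _ fun ω => hB (Y ω))

lemma abs_integral_le_of_abs_le {g : Ω → ℝ} {B : ℝ} (h : ∀ ω, |g ω| ≤ B) :
    |∫ ω, g ω ∂ρ| ≤ B := by
  have := norm_integral_le_of_norm_le_const (μ := ρ) (f := g) (C := B)
    (ae_of_all _ fun ω => by rw [Real.norm_eq_abs]; exact h ω)
  simpa using this

omit [IsProbabilityMeasure ρ] in
lemma integral_ite_eq {V : Type*} [MeasurableSpace V] [MeasurableSingletonClass V]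
    [DecidableEq V] {Y : Ω → V} (hY : Measurable Y) (v : V) :
    ∫ ω, (if Y ω = v then (1 : ℝ) else 0) ∂ρ = ρ.real {ω | Y ω = v} := by
  rw [← integral_indicator_one (show MeasurableSet {ω | Y ω = v} from
    hY (measurableSet_singleton v))]
  congr 1 with ω
  simp [Set.indicator_apply]

omit [IsProbabilityMeasure ρ] in
lemma IsMAGRandomness.measurable_levels (hR : IsMAGRandomness T Z J I ρ) :
    Measurable fun ω t => J t ω :=
  measurable_pi_lambda _ hR.measurable_level

/-- Independence makes the joint law a product, and Fubini integrates over the chain with the levels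
held fixed. -/
lemma IsMAGRandomness.integral_eq_integral_integral (hR : IsMAGRandomness T Z J I ρ)
    (hZ : ∀ n, Measurable (Z n)) {X : (ℕ → ℕ) → (ℕ → S) → ℝ}
    (hX : Measurable fun q : (ℕ → ℕ) × (ℕ → S) => X q.1 q.2) {B : ℝ} (hB : ∀ j z, |X j z| ≤ B) :
    ∫ ω, X (fun t => J t ω) (fun n => Z n ω) ∂ρ
      = ∫ ω, ∫ ω', X (fun t => J t ω) (fun n => Z n ω') ∂ρ ∂ρ := by
  have hJm := hR.measurable_levels
  have hZm : Measurable fun ω n => Z n ω := measurable_pi_lambda _ hZ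
  have hprod := (indepFun_iff_map_prod_eq_prod_map_map hJm.aemeasurable hZm.aemeasurable).1
    hR.indep_data
  have : IsProbabilityMeasure (ρ.map fun ω t => J t ω) :=
    Measure.isProbabilityMeasure_map hJm.aemeasurable
  have : IsProbabilityMeasure (ρ.map fun ω n => Z n ω) :=
    Measure.isProbabilityMeasure_map hZm.aemeasurable
  have h1 : ∫ ω, X (fun t => J t ω) (fun n => Z n ω) ∂ρ
      = ∫ q, X q.1 q.2 ∂(ρ.map fun ω => ((fun t => J t ω), (fun n => Z n ω))) :=
    (integral_map (hJm.prodMk hZm).aemeasurable hX.aestronglyMeasurable).symm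
  rw [h1, hprod, integral_prod _ (Integrable.of_bound hX.aestronglyMeasurable B
    (ae_of_all _ fun q => hB q.1 q.2))]
  have h2 : ∀ j : ℕ → ℕ, ∫ z, X j z ∂(ρ.map fun ω n => Z n ω)
      = ∫ ω', X j (fun n => Z n ω') ∂ρ := fun j =>
    integral_map hZm.aemeasurable (hX.comp measurable_prodMk_left).aestronglyMeasurable
  rw [integral_map hJm.aemeasurable]
  · simp only [h2]
  · exact (hX.stronglyMeasurable.integral_prod_right (ν := ρ.map fun ω n => Z n ω)
      ).aestronglyMeasurable

lemma measurable_ite_level (t i : ℕ) :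
    Measurable fun q : (ℕ → ℕ) × (ℕ → S) => if q.1 t = i then (1 : ℝ) else 0 :=
  (Measurable.of_discrete (f := fun n : ℕ => if n = i then (1 : ℝ) else 0)).comp
    ((measurable_pi_apply t).comp measurable_fst)

lemma abs_ite_mul_le (p : Prop) [Decidable p] {x B : ℝ} (h : |x| ≤ B) :
    |(if p then (1 : ℝ) else 0) * x| ≤ B := by
  split_ifs
  · rwa [one_mul]
  · rw [zero_mul, abs_zero]
    exact (abs_nonneg x).trans h

omit [IsProbabilityMeasure ρ] in
lemma IsMAGRandomness.integral_ite_level (hR : IsMAGRandomness T Z J I ρ) (t : ℕ) {i : ℕ}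
    (hi : 1 ≤ i) : ∫ ω, (if J t ω = i then (1 : ℝ) else 0) ∂ρ = (1 / 2) ^ i := by
  rw [← hR.geometric t i hi, integral_ite_eq (hR.measurable_level t)]

/-- The level of an iteration is independent of everything determined by the previous levels and
the data. -/
lemma IsMAGRandomness.integral_ite_level_mul (hR : IsMAGRandomness T Z J I ρ)
    (hZ : ∀ n, Measurable (Z n)) {X : (ℕ → ℕ) → (ℕ → S) → ℝ}
    (hX : Measurable fun q : (ℕ → ℕ) × (ℕ → S) => X q.1 q.2) {B : ℝ} (hB : ∀ j z, |X j z| ≤ B)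
    {t i : ℕ} (hi : 1 ≤ i) (hXt : ∀ z, DependsOn (fun j => X j z) (Set.Iio t)) :
    ∫ ω, (if J t ω = i then (1 : ℝ) else 0) * X (fun t => J t ω) (fun n => Z n ω) ∂ρ
      = (1 / 2) ^ i * ∫ ω, X (fun t => J t ω) (fun n => Z n ω) ∂ρ := by
  rw [hR.integral_eq_integral_integral hZ
      (X := fun j z => (if j t = i then (1 : ℝ) else 0) * X j z)
      ((measurable_ite_level t i).mul hX) (fun j z => abs_ite_mul_le _ (hB j z)),
    hR.integral_eq_integral_integral hZ hX hB]
  simp only [integral_const_mul]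
  -- After the data are integrated out, only the first t levels matter; filling the others with 0 is
  -- harmless by `hXt`, and J_t is independent of what remains.
  let y : ((k : Finset.range t) → ℕ) → ℝ := fun u =>
    ∫ ω', X (fun k => if h : k ∈ Finset.range t then u ⟨k, h⟩ else 0) (fun n => Z n ω') ∂ρ
  have hy : ∀ ω, ∫ ω', X (fun t => J t ω) (fun n => Z n ω') ∂ρ
      = y fun k : Finset.range t => J k ω := by
    intro ω
    refine integral_congr_ae (ae_of_all _ fun ω' => hXt _ fun k hk => ?_)
    simp [Set.mem_Iio.1 hk]
  simp only [hy]
  have hrestr : ∀ K : Finset ℕ, Measurable fun ω (k : K) => J k ω := fun K =>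
    measurable_pi_lambda _ fun k => hR.measurable_level k
  have hind := (hR.indep_levels.indepFun_finset {t} (Finset.range t) (by simp)
    hR.measurable_level).comp
    (φ := fun u : ((k : ({t} : Finset ℕ)) → ℕ) =>
      if u ⟨t, Finset.mem_singleton_self t⟩ = i then (1 : ℝ) else 0) (ψ := y)
    Measurable.of_discrete Measurable.of_discrete
  have h1 := hind.integral_fun_mul_eq_mul_integral
    (Measurable.of_discrete.comp
      (hrestr {t})).aestronglyMeasurable
    (Measurable.of_discrete.comp (hrestr (Finset.range t))).aestronglyMeasurable
  simp only [Function.comp_apply] at h1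
  rw [h1, hR.integral_ite_level t hi]

/-- The bound b is uniform over frozen levels, so X needs no independence from J_t: the inner
integral is replaced by b before the indicator is integrated. -/
lemma IsMAGRandomness.integral_ite_level_mul_le (hR : IsMAGRandomness T Z J I ρ)
    (hZ : ∀ n, Measurable (Z n)) {X : (ℕ → ℕ) → (ℕ → S) → ℝ}
    (hX : Measurable fun q : (ℕ → ℕ) × (ℕ → S) => X q.1 q.2) {B : ℝ} (hB : ∀ j z, |X j z| ≤ B)
    {t i : ℕ} (hi : 1 ≤ i) {b : ℝ} (hb : ∀ j, ∫ ω, X j (fun n => Z n ω) ∂ρ ≤ b) :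
    ∫ ω, (if J t ω = i then (1 : ℝ) else 0) * X (fun t => J t ω) (fun n => Z n ω) ∂ρ
      ≤ (1 / 2) ^ i * b := by
  rw [hR.integral_eq_integral_integral hZ
      (X := fun j z => (if j t = i then (1 : ℝ) else 0) * X j z)
      ((measurable_ite_level t i).mul hX) (fun j z => abs_ite_mul_le _ (hB j z))]
  simp only [integral_const_mul]
  have hite : Measurable fun ω => if J t ω = i then (1 : ℝ) else 0 :=
    (Measurable.of_discrete (f := fun n : ℕ => if n = i then (1 : ℝ) else 0)).comp
      (hR.measurable_level t)
  have hite_int : Integrable (fun ω => if J t ω = i then (1 : ℝ) else 0) ρ :=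
    Integrable.of_bound hite.aestronglyMeasurable 1 (ae_of_all _ fun ω => by
      split_ifs <;> simp)
  have hZm : Measurable fun ω n => Z n ω := measurable_pi_lambda _ hZ
  have hY : Measurable fun ω => ∫ ω', X (fun t => J t ω) (fun n => Z n ω') ∂ρ := by
    have h2 : Measurable fun q : Ω × Ω => ((fun t => J t q.1), (fun n => Z n q.2)) :=
      (hR.measurable_levels.comp measurable_fst).prodMk (hZm.comp measurable_snd)
    exact (StronglyMeasurable.integral_prod_right (ν := ρ)
      (f := fun ω ω' => X (fun t => J t ω) (fun n => Z n ω'))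
      (hX.comp h2).stronglyMeasurable).measurable
  have hYB : ∀ ω, |∫ ω', X (fun t => J t ω) (fun n => Z n ω') ∂ρ| ≤ B := fun ω =>
    abs_integral_le_of_abs_le fun ω' => hB _ _
  calc _ ≤ ∫ ω, (if J t ω = i then (1 : ℝ) else 0) * b ∂ρ := by
        refine integral_mono ?_ (hite_int.mul_const b) fun ω =>
          mul_le_mul_of_nonneg_left (hb _) (by split_ifs <;> norm_num)
        exact Integrable.of_bound (hite.mul hY).aestronglyMeasurable B
          (ae_of_all _ fun ω => abs_ite_mul_le _ (hYB ω))
    _ = (1 / 2) ^ i * b := by rw [integral_mul_const, hR.integral_ite_level t hi]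

lemma IsMAGRandomness.integral_le (hR : IsMAGRandomness T Z J I ρ)
    (hZ : ∀ n, Measurable (Z n)) {X : (ℕ → ℕ) → (ℕ → S) → ℝ}
    (hX : Measurable fun q : (ℕ → ℕ) × (ℕ → S) => X q.1 q.2) {B : ℝ} (hB : ∀ j z, |X j z| ≤ B)
    {b : ℝ} (hb : ∀ j, |∫ ω, X j (fun n => Z n ω) ∂ρ| ≤ b) :
    |∫ ω, X (fun t => J t ω) (fun n => Z n ω) ∂ρ| ≤ b := by
  rw [hR.integral_eq_integral_integral hZ hX hB]
  exact abs_integral_le_of_abs_le fun ω => hb _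

/-- Averaging over the random index. -/
lemma IsMAGRandomness.integral_index (hR : IsMAGRandomness T Z J I ρ)
    (hZ : ∀ n, Measurable (Z n)) {X : ℕ → (ℕ → ℕ) → (ℕ → S) → ℝ}
    (hX : ∀ t, Measurable fun q : (ℕ → ℕ) × (ℕ → S) => X t q.1 q.2) {B : ℝ}
    (hB : ∀ t j z, |X t j z| ≤ B) :
    Integrable (fun ω => X (I ω) (fun t => J t ω) (fun n => Z n ω)) ρ ∧
    ∫ ω, X (I ω) (fun t => J t ω) (fun n => Z n ω) ∂ρ
      = (∑ t ∈ Finset.range T, ∫ ω, X t (fun t => J t ω) (fun n => Z n ω) ∂ρ) / T := by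
  have hJZ : Measurable fun ω => ((fun t => J t ω), (fun n => Z n ω)) :=
    hR.measurable_levels.prodMk (measurable_pi_lambda _ hZ)
  have heq : ∀ ω, X (I ω) (fun t => J t ω) (fun n => Z n ω)
      = ∑ s : Fin T, (if I ω = s then (1 : ℝ) else 0)
        * X s (fun t => J t ω) (fun n => Z n ω) := fun ω => by simp
  have hite : ∀ s : Fin T, Measurable fun r : Fin T => if r = s then (1 : ℝ) else 0 :=
    fun s => Measurable.of_discrete
  have hint : ∀ s : Fin T, Integrable (fun ω => (if I ω = s then (1 : ℝ) else 0)
        * X s (fun t => J t ω) (fun n => Z n ω)) ρ := fun s =>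
    Integrable.of_bound (((hite s).comp hR.measurable_index).mul
      ((hX s).comp hJZ)).aestronglyMeasurable B (ae_of_all _ fun ω => abs_ite_mul_le _ (hB _ _ _))
  simp only [heq]
  refine ⟨integrable_finsetSum _ fun s _ => hint s, ?_⟩
  rw [integral_finsetSum _ fun s _ => hint s, Finset.sum_div, ← Fin.sum_univ_eq_sum_range
    (fun t => (∫ ω, X t (fun t => J t ω) (fun n => Z n ω) ∂ρ) / T)]
  refine Finset.sum_congr rfl fun s _ => ?_
  have hind := hR.indep_index.comp (hite s) (hX s)
  have h1 := hind.integral_fun_mul_eq_mul_integral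
    ((hite s).comp hR.measurable_index).aestronglyMeasurable
    ((hX s).comp hJZ).aestronglyMeasurable
  simp only [Function.comp_apply] at h1
  have h2 : ∫ ω, (if I ω = s then (1 : ℝ) else 0) ∂ρ = 1 / T := by
    rw [← hR.uniform s, integral_ite_eq hR.measurable_index]
  rw [h1, h2]
  ring

end Randomness

/-! ### Moments of the gradient estimators -/

section Moments

variable {Ω : Type*} [MeasurableSpace Ω] {ρ : Measure Ω} [IsProbabilityMeasure ρ]
  {S : Type*} [Fintype S] [DecidableEq S] [MeasurableSpace S] [MeasurableSingletonClass S]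
  {P : Matrix S S ℝ} {μ : S → ℝ} {Z : ℕ → Ω → S} {d : ℕ}
  {f : EuclideanSpace ℝ (Fin d) → S → ℝ} {α L G : ℝ} {T : ℕ} {N : ℕ → ℕ}
  {w₁ : EuclideanSpace ℝ (Fin d)} {J : ℕ → Ω → ℕ} {I : Ω → Fin T}

/-- The gradient of the objective at the iterate of iteration `t`. -/
noncomputable def trueGrad (f : EuclideanSpace ℝ (Fin d) → S → ℝ) (μ : S → ℝ) (α : ℝ) (T : ℕ)
    (N : ℕ → ℕ) (w₁ : EuclideanSpace ℝ (Fin d)) (t : ℕ) (j : ℕ → ℕ) (z : ℕ → S) :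
    EuclideanSpace ℝ (Fin d) :=
  ∇ (objective f μ) (magIterate f α T N w₁ z j t)

omit [DecidableEq S] in
lemma measurable_trueGrad (hF : IsLSmooth (objective f μ) L) (hL : 0 ≤ L) (t : ℕ) :
    Measurable fun q : (ℕ → ℕ) × (ℕ → S) => trueGrad f μ α T N w₁ t q.1 q.2 :=
  (hF.measurable_gradient hL).comp (measurable_magIterate t)

omit [DecidableEq S] [MeasurableSpace S] [MeasurableSingletonClass S] in
lemma HasBoundedGradients.norm_levelGrad_sub_trueGrad_le (hf : HasBoundedGradients f G)
    (hμ : μ ∈ stdSimplex ℝ S) (t i : ℕ) (j : ℕ → ℕ) (z : ℕ → S) :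
    ‖levelGrad f α T N w₁ t i j z - trueGrad f μ α T N w₁ t j z‖ ≤ 2 * G :=
  (norm_sub_le _ _).trans (by
    have h1 := hf.norm_batchGrad_le z (magState f α T N w₁ z j t).used
      (magState f α T N w₁ z j t).point i
    have h2 := hf.norm_gradient_objective_le hμ (magIterate f α T N w₁ z j t)
    unfold levelGrad trueGrad
    linarith)

-- Only indices strictly below the sum are read. Allowing the endpoint fits the chain estimates and
-- covers t = 0, when there is no earlier sample.
omit [Fintype S] [DecidableEq S] [MeasurableSpace S] [MeasurableSingletonClass S] in
lemma IsSampleCount.dependsOn_magIterate (hN : IsSampleCount T N) (j : ℕ → ℕ) (t : ℕ) :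
    DependsOn (fun z : ℕ → S => magIterate f α T N w₁ z j t)
      (Set.Iic (∑ k ∈ Finset.range t, N (j k))) := fun _ _ h =>
  congrArg MAGState.point (hN.magState_congr j t fun i hi => h i (Set.mem_Iic.2 hi.le))

lemma IsMAGRandomness.abs_integral_inner_levelGrad_sub_le (hR : IsMAGRandomness T Z J I ρ)
    (hZ : IsMarkovChain P Z ρ)
    (hP : P ∈ Matrix.rowStochastic ℝ S) (hE : IsErgodicMatrix P)
    (hμ : IsStationaryDistribution P μ) (hf : HasBoundedGradients f G) (hG : 0 ≤ G)
    (hF : IsLSmooth (objective f μ) L) (hL : 0 ≤ L) (hN : IsSampleCount T N) (t i : ℕ) :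
    |∫ ω, inner ℝ (trueGrad f μ α T N w₁ t (fun t => J t ω) (fun n => Z n ω))
        (levelGrad f α T N w₁ t i (fun t => J t ω) (fun n => Z n ω)
          - trueGrad f μ α T N w₁ t (fun t => J t ω) (fun n => Z n ω)) ∂ρ|
      ≤ 8 * mixingTime P μ * G ^ 2 / 2 ^ i := by
  refine hR.integral_le hZ.measurable (B := G * (2 * G))
    (X := fun j z => inner ℝ (trueGrad f μ α T N w₁ t j z)
      (levelGrad f α T N w₁ t i j z - trueGrad f μ α T N w₁ t j z))
    ((measurable_trueGrad hF hL t).inner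
      ((measurable_levelGrad t i).sub (measurable_trueGrad hF hL t))) ?_ ?_
  · exact fun j z => (abs_real_inner_le_norm _ _).trans
      (mul_le_mul (hf.norm_gradient_objective_le hμ.mem_stdSimplex _)
        (hf.norm_levelGrad_sub_trueGrad_le hμ.mem_stdSimplex t i j z) (norm_nonneg _) hG)
  · intro j
    -- With frozen levels the number of consumed samples is a constant, so the estimate for a fixed
    -- starting position applies.
    simp only [levelGrad, magState_used]
    exact hZ.abs_integral_inner_batchGrad_sub_le hP hE hμ hf hG
      (hN.dependsOn_magIterate j t) i

lemma IsMAGRandomness.integral_ite_norm_levelGrad_sub_sq_le (hR : IsMAGRandomness T Z J I ρ)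
    (hZ : IsMarkovChain P Z ρ)
    (hP : P ∈ Matrix.rowStochastic ℝ S) (hE : IsErgodicMatrix P)
    (hμ : IsStationaryDistribution P μ) (hf : HasBoundedGradients f G) (hG : 0 ≤ G)
    (hF : IsLSmooth (objective f μ) L) (hL : 0 ≤ L) (hN : IsSampleCount T N) (t i : ℕ)
    {l : ℕ} (hl : 1 ≤ l) :
    Integrable (fun ω => (if J t ω = l then (1 : ℝ) else 0) *
        ‖levelGrad f α T N w₁ t i (fun t => J t ω) (fun n => Z n ω)
          - trueGrad f μ α T N w₁ t (fun t => J t ω) (fun n => Z n ω)‖ ^ 2) ρ ∧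
    ∫ ω, (if J t ω = l then (1 : ℝ) else 0) *
        ‖levelGrad f α T N w₁ t i (fun t => J t ω) (fun n => Z n ω)
          - trueGrad f μ α T N w₁ t (fun t => J t ω) (fun n => Z n ω)‖ ^ 2 ∂ρ
      ≤ (1 / 2) ^ l * (32 * mixingTime P μ * G ^ 2 / 2 ^ i) := by
  have hm : Measurable fun q : (ℕ → ℕ) × (ℕ → S) =>
      ‖levelGrad f α T N w₁ t i q.1 q.2 - trueGrad f μ α T N w₁ t q.1 q.2‖ ^ 2 :=
    ((measurable_levelGrad t i).sub (measurable_trueGrad hF hL t)).norm.pow_const 2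
  have hB : ∀ j z, |‖levelGrad f α T N w₁ t i j z - trueGrad f μ α T N w₁ t j z‖ ^ 2|
      ≤ (2 * G) ^ 2 := fun j z => by
    rw [abs_of_nonneg (by positivity)]
    exact pow_le_pow_left₀ (norm_nonneg _)
      (hf.norm_levelGrad_sub_trueGrad_le hμ.mem_stdSimplex t i j z) 2
  refine ⟨integrable_comp_of_abs_le (Y := fun ω => ((fun t => J t ω), fun n => Z n ω))
    (hR.measurable_levels.prodMk (measurable_pi_lambda _ hZ.measurable))
    (X := fun q => (if q.1 t = l then (1 : ℝ) else 0) *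
      ‖levelGrad f α T N w₁ t i q.1 q.2 - trueGrad f μ α T N w₁ t q.1 q.2‖ ^ 2)
    ((measurable_ite_level t l).mul hm) (fun q => abs_ite_mul_le _ (hB q.1 q.2)), ?_⟩
  refine hR.integral_ite_level_mul_le hZ.measurable
    (X := fun j z => ‖levelGrad f α T N w₁ t i j z - trueGrad f μ α T N w₁ t j z‖ ^ 2)
    hm hB hl fun j => ?_
  simp only [levelGrad, magState_used]
  exact hZ.integral_norm_batchGrad_sub_sq_le hP hE hμ hf hG (hN.dependsOn_magIterate j t) i

/-- The multi-level estimator costs a factor `τ_mix log T` in the second moment. -/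
lemma IsMAGRandomness.integral_norm_stepGrad_sq_le (hR : IsMAGRandomness T Z J I ρ)
    (hZ : IsMarkovChain P Z ρ)
    (hP : P ∈ Matrix.rowStochastic ℝ S) (hE : IsErgodicMatrix P)
    (hμ : IsStationaryDistribution P μ) (hf : HasBoundedGradients f G) (hG : 0 ≤ G)
    (hF : IsLSmooth (objective f μ) L) (hL : 0 ≤ L) (hN : IsSampleCount T N) (hT : 1 ≤ T)
    (t : ℕ) :
    Integrable (fun ω => ‖stepGrad f α T N w₁ t (fun t => J t ω) (fun n => Z n ω)‖ ^ 2) ρ ∧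
    ∫ ω, ‖stepGrad f α T N w₁ t (fun t => J t ω) (fun n => Z n ω)‖ ^ 2 ∂ρ
      ≤ 2 * G ^ 2 + 384 * (Nat.log 2 T * mixingTime P μ) * G ^ 2 := by
  have hJZ : Measurable fun ω => ((fun t => J t ω), fun n => Z n ω) :=
    hR.measurable_levels.prodMk (measurable_pi_lambda _ hZ.measurable)
  have hint : Integrable
      (fun ω => ‖stepGrad f α T N w₁ t (fun t => J t ω) (fun n => Z n ω)‖ ^ 2) ρ :=
    integrable_comp_of_abs_le hJZ (X := fun q => ‖stepGrad f α T N w₁ t q.1 q.2‖ ^ 2)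
      ((measurable_stepGrad t).norm.pow_const 2) (B := (G + T * (2 * G)) ^ 2) fun q => by
        rw [abs_of_nonneg (by positivity)]
        exact pow_le_pow_left₀ (norm_nonneg _) (hf.norm_stepGrad_le hG t _ _) 2
  refine ⟨hint, ?_⟩
  have hmom := fun i l (hl : 1 ≤ l) => hR.integral_ite_norm_levelGrad_sub_sq_le (α := α)
    (w₁ := w₁) hZ hP hE hμ hf hG hF hL hN t i hl
  have hbound : ∀ ω, ‖stepGrad f α T N w₁ t (fun t => J t ω) (fun n => Z n ω)‖ ^ 2
      ≤ 2 * G ^ 2 + ∑ i ∈ Finset.range (Nat.log 2 T), (4 : ℝ) ^ (i + 2) *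
        ((if J t ω = i + 1 then (1 : ℝ) else 0) *
          ‖levelGrad f α T N w₁ t (i + 1) (fun t => J t ω) (fun n => Z n ω)
            - trueGrad f μ α T N w₁ t (fun t => J t ω) (fun n => Z n ω)‖ ^ 2
        + (if J t ω = i + 1 then (1 : ℝ) else 0) *
          ‖levelGrad f α T N w₁ t i (fun t => J t ω) (fun n => Z n ω)
            - trueGrad f μ α T N w₁ t (fun t => J t ω) (fun n => Z n ω)‖ ^ 2) := by
    intro ω
    refine (norm_stepGrad_sq_le hT t _ _
      (trueGrad f μ α T N w₁ t (fun t => J t ω) (fun n => Z n ω))).trans ?_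
    simp only [mul_add]
    gcongr
    exact hf.norm_batchGrad_le _ _ _ _
  have hint' : ∀ i ∈ Finset.range (Nat.log 2 T), Integrable (fun ω => (4 : ℝ) ^ (i + 2) *
        ((if J t ω = i + 1 then (1 : ℝ) else 0) *
          ‖levelGrad f α T N w₁ t (i + 1) (fun t => J t ω) (fun n => Z n ω)
            - trueGrad f μ α T N w₁ t (fun t => J t ω) (fun n => Z n ω)‖ ^ 2
        + (if J t ω = i + 1 then (1 : ℝ) else 0) *
          ‖levelGrad f α T N w₁ t i (fun t => J t ω) (fun n => Z n ω)
            - trueGrad f μ α T N w₁ t (fun t => J t ω) (fun n => Z n ω)‖ ^ 2)) ρ := fun i _ =>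
    ((hmom (i + 1) (i + 1) (by omega)).1.add (hmom i (i + 1) (by omega)).1).const_mul _
  refine (integral_mono hint ((integrable_const _).add (integrable_finsetSum _ hint'))
    hbound).trans ?_
  simp only [Pi.add_apply]
  rw [integral_add (integrable_const _) (integrable_finsetSum _ hint'),
    integral_finsetSum _ hint', integral_const, probReal_univ, one_smul]
  gcongr
  -- Each level gives 4^{i+2} · 2^{-(i+1)} · 32(2^{-(i+1)} + 2^{-i}) = 384, independent of i: this
  -- is the logarithmic price of the multi-level scheme.
  calc _ ≤ ∑ i ∈ Finset.range (Nat.log 2 T), 384 * (mixingTime P μ : ℝ) * G ^ 2 := by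
        refine Finset.sum_le_sum fun i _ => ?_
        have h1 := hmom (i + 1) (i + 1) (by omega)
        have h2 := hmom i (i + 1) (by omega)
        rw [integral_const_mul, integral_add h1.1 h2.1]
        refine (mul_le_mul_of_nonneg_left (add_le_add h1.2 h2.2) (by positivity)).trans_eq ?_
        have h4 : (4 : ℝ) ^ i = 2 ^ i * 2 ^ i := by rw [← mul_pow]; norm_num
        rw [pow_succ (1 / 2 : ℝ) i, pow_add (4 : ℝ) i 2, h4, pow_succ (2 : ℝ) i, one_div_pow]
        field_simp
        ring
    _ = 384 * (Nat.log 2 T * mixingTime P μ) * G ^ 2 := by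
        rw [Finset.sum_const, Finset.card_range, nsmul_eq_mul]
        ring

omit [DecidableEq S] in
/-- On average the multi-level estimator is as good as the average over the largest batch. -/
lemma IsMAGRandomness.integral_inner_stepGrad (hR : IsMAGRandomness T Z J I ρ)
    (hZ : ∀ n, Measurable (Z n))
    (hμ : μ ∈ stdSimplex ℝ S) (hf : HasBoundedGradients f G) (hG : 0 ≤ G)
    (hF : IsLSmooth (objective f μ) L) (hL : 0 ≤ L) (hT : 1 ≤ T) (t : ℕ) :
    ∫ ω, inner ℝ (trueGrad f μ α T N w₁ t (fun t => J t ω) (fun n => Z n ω))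
        (stepGrad f α T N w₁ t (fun t => J t ω) (fun n => Z n ω)) ∂ρ
      = ∫ ω, inner ℝ (trueGrad f μ α T N w₁ t (fun t => J t ω) (fun n => Z n ω))
        (levelGrad f α T N w₁ t (Nat.log 2 T) (fun t => J t ω) (fun n => Z n ω)) ∂ρ := by
  have hJZ : Measurable fun ω => ((fun t => J t ω), fun n => Z n ω) :=
    hR.measurable_levels.prodMk (measurable_pi_lambda _ hZ)
  let U : ℕ → (ℕ → ℕ) → (ℕ → S) → ℝ := fun i j z =>
    inner ℝ (trueGrad f μ α T N w₁ t j z) (levelGrad f α T N w₁ t i j z)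
  have hUm : ∀ i, Measurable fun q : (ℕ → ℕ) × (ℕ → S) => U i q.1 q.2 := fun i =>
    (measurable_trueGrad hF hL t).inner (measurable_levelGrad t i)
  have hUB : ∀ i j z, |U i j z| ≤ G * G := fun i j z =>
    (abs_real_inner_le_norm _ _).trans (mul_le_mul (hf.norm_gradient_objective_le hμ _)
      (hf.norm_batchGrad_le _ _ _ _) (norm_nonneg _) hG)
  have hUD : ∀ i z, DependsOn (fun j => U i j z) (Set.Iio t) := fun i z j j' h => by
    simp only [U, trueGrad, levelGrad, magIterate]
    rw [magState_levels_congr z t fun k hk => h k hk]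
  have hUi : ∀ i, Integrable (fun ω => U i (fun t => J t ω) (fun n => Z n ω)) ρ := fun i =>
    integrable_comp_of_abs_le hJZ (hUm i) fun q => hUB i q.1 q.2
  have hiUm : ∀ i l, Integrable (fun ω => (if J t ω = l then (1 : ℝ) else 0) *
      U i (fun t => J t ω) (fun n => Z n ω)) ρ := fun i l =>
    integrable_comp_of_abs_le hJZ
      (X := fun q => (if q.1 t = l then (1 : ℝ) else 0) * U i q.1 q.2)
      ((measurable_ite_level t l).mul (hUm i)) fun q => abs_ite_mul_le _ (hUB i q.1 q.2)
  have hexp : ∀ ω, inner ℝ (trueGrad f μ α T N w₁ t (fun t => J t ω) (fun n => Z n ω))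
        (stepGrad f α T N w₁ t (fun t => J t ω) (fun n => Z n ω))
      = U 0 (fun t => J t ω) (fun n => Z n ω) + ∑ i ∈ Finset.range (Nat.log 2 T),
        (2 : ℝ) ^ (i + 1) * ((if J t ω = i + 1 then (1 : ℝ) else 0) *
            U (i + 1) (fun t => J t ω) (fun n => Z n ω)
          - (if J t ω = i + 1 then (1 : ℝ) else 0) *
            U i (fun t => J t ω) (fun n => Z n ω)) := fun ω => by
    rw [stepGrad_eq_sum hT, inner_add_right, inner_sum]
    congr 1
    refine Finset.sum_congr rfl fun i _ => ?_
    split_ifs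
    · rw [inner_smul_right, inner_sub_right, one_mul, one_mul]
    · simp
  have hterm : ∀ i ∈ Finset.range (Nat.log 2 T), Integrable (fun ω =>
        (2 : ℝ) ^ (i + 1) * ((if J t ω = i + 1 then (1 : ℝ) else 0) *
            U (i + 1) (fun t => J t ω) (fun n => Z n ω)
          - (if J t ω = i + 1 then (1 : ℝ) else 0) *
            U i (fun t => J t ω) (fun n => Z n ω))) ρ := fun i _ =>
    ((hiUm (i + 1) (i + 1)).sub (hiUm i (i + 1))).const_mul _
  simp only [hexp]
  rw [integral_add (hUi 0) (integrable_finsetSum _ hterm), integral_finsetSum _ hterm]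
  -- The weight 2^{i+1} cancels the probability of level i + 1, because the iterate and its batch
  -- averages depend on earlier levels only (`hUD`).
  have hval : ∀ i ∈ Finset.range (Nat.log 2 T), ∫ ω,
        (2 : ℝ) ^ (i + 1) * ((if J t ω = i + 1 then (1 : ℝ) else 0) *
            U (i + 1) (fun t => J t ω) (fun n => Z n ω)
          - (if J t ω = i + 1 then (1 : ℝ) else 0) *
            U i (fun t => J t ω) (fun n => Z n ω)) ∂ρ
      = ∫ ω, U (i + 1) (fun t => J t ω) (fun n => Z n ω) ∂ρ
        - ∫ ω, U i (fun t => J t ω) (fun n => Z n ω) ∂ρ := fun i _ => by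
    rw [integral_const_mul, integral_sub (hiUm _ _) (hiUm _ _),
      hR.integral_ite_level_mul hZ (hUm _) (hUB _) (by omega) (hUD _),
      hR.integral_ite_level_mul hZ (hUm _) (hUB _) (by omega) (hUD _), one_div_pow]
    field_simp
  rw [Finset.sum_congr rfl hval,
    Finset.sum_range_sub (fun i => ∫ ω, U i (fun t => J t ω) (fun n => Z n ω) ∂ρ)]
  ring

end Moments

/-! ### The convergence rate -/

section Rate

variable {Ω : Type*} [MeasurableSpace Ω] {ρ : Measure Ω} [IsProbabilityMeasure ρ]

lemma sq_integral_le_integral_sq {X : Ω → ℝ} (hX : Integrable X ρ)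
    (hX2 : Integrable (fun ω => X ω ^ 2) ρ) : (∫ ω, X ω ∂ρ) ^ 2 ≤ ∫ ω, X ω ^ 2 ∂ρ := by
  set c := ∫ ω, X ω ∂ρ with hc
  have h : ∫ ω, (2 * c * X ω - c ^ 2) ∂ρ ≤ ∫ ω, X ω ^ 2 ∂ρ :=
    integral_mono ((hX.const_mul _).sub (integrable_const _)) hX2 fun ω => by
      have := sq_nonneg (X ω - c)
      dsimp only
      linarith
  rw [integral_sub (hX.const_mul _) (integrable_const _), integral_const_mul, integral_const,
    probReal_univ, one_smul, ← hc] at h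
  linarith

variable {S : Type*} [Fintype S] [DecidableEq S] [MeasurableSpace S] [MeasurableSingletonClass S]
  {P : Matrix S S ℝ} {μ : S → ℝ} {Z : ℕ → Ω → S} {d : ℕ}
  {f : EuclideanSpace ℝ (Fin d) → S → ℝ} {M L G : ℝ} {T : ℕ} {N : ℕ → ℕ}
  {w₁ : EuclideanSpace ℝ (Fin d)} {J : ℕ → Ω → ℕ} {I : Ω → Fin T}

omit [Fintype S] [DecidableEq S] [MeasurableSpace S] [MeasurableSingletonClass S] in
lemma magState_sumSq (j : ℕ → ℕ) (z : ℕ → S) (n : ℕ) :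
    (magState f 1 T N w₁ z j n).sumSq
      = ∑ t ∈ Finset.range n, ‖stepGrad f 1 T N w₁ t j z‖ ^ 2 := by
  induction n with
  | zero => rfl
  | succ n ih => rw [Finset.sum_range_succ, ← ih]; rfl

omit [DecidableEq S] [MeasurableSpace S] [MeasurableSingletonClass S] in
lemma IsLSmooth.sum_inner_stepGrad_le (hF : IsLSmooth (objective f μ) L) (hL : 0 ≤ L)
    (hM : ∀ w, |objective f μ w| ≤ M) (j : ℕ → ℕ) (z : ℕ → S) (n : ℕ) :
    ∑ t ∈ Finset.range n, inner ℝ (trueGrad f μ 1 T N w₁ t j z) (stepGrad f 1 T N w₁ t j z)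
      ≤ (2 * M + 2 * L) * √(∑ t ∈ Finset.range n, ‖stepGrad f 1 T N w₁ t j z‖ ^ 2) := by
  rw [← magState_sumSq]
  exact hF.sum_inner_le hL hM (w := magIterate f 1 T N w₁ z j)
    (v := fun t => (magState f 1 T N w₁ z j t).sumSq) rfl (fun t => rfl) (fun t => rfl) n

lemma IsMAGRandomness.sum_integral_norm_trueGrad_sq_le (hR : IsMAGRandomness T Z J I ρ)
    (hZ : IsMarkovChain P Z ρ)
    (hP : P ∈ Matrix.rowStochastic ℝ S) (hE : IsErgodicMatrix P)
    (hμ : IsStationaryDistribution P μ) (hf : HasBoundedGradients f G) (hG : 0 ≤ G)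
    (hF : IsLSmooth (objective f μ) L) (hL : 0 ≤ L) (hM0 : 0 ≤ M)
    (hM : ∀ w, |objective f μ w| ≤ M) (hN : IsSampleCount T N) (hT : 1 ≤ T) :
    ∑ t ∈ Finset.range T,
        ∫ ω, ‖trueGrad f μ 1 T N w₁ t (fun t => J t ω) (fun n => Z n ω)‖ ^ 2 ∂ρ
      ≤ (2 * M + 2 * L) *
          √(T * (2 * G ^ 2 + 384 * (Nat.log 2 T * mixingTime P μ) * G ^ 2))
        + T * (8 * mixingTime P μ * G ^ 2 / 2 ^ Nat.log 2 T) := by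
  have hJZ : Measurable fun ω => ((fun t => J t ω), fun n => Z n ω) :=
    hR.measurable_levels.prodMk (measurable_pi_lambda _ hZ.measurable)
  have hA : ∀ t j z, ‖trueGrad f μ 1 T N w₁ t j z‖ ≤ G := fun t j z =>
    hf.norm_gradient_objective_le hμ.mem_stdSimplex _
  have hAm := fun t => measurable_trueGrad (α := 1) (T := T) (N := N) (w₁ := w₁) hF hL t
  have hAl : ∀ t i, Integrable (fun ω => (inner ℝ
      (trueGrad f μ 1 T N w₁ t (fun t => J t ω) (fun n => Z n ω))
      (levelGrad f 1 T N w₁ t i (fun t => J t ω) (fun n => Z n ω)) : ℝ)) ρ := fun t i =>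
    integrable_comp_of_abs_le hJZ (B := G * G)
      (X := fun q => inner ℝ (trueGrad f μ 1 T N w₁ t q.1 q.2) (levelGrad f 1 T N w₁ t i q.1 q.2))
      ((hAm t).inner (measurable_levelGrad t i)) fun q => (abs_real_inner_le_norm _ _).trans
        (mul_le_mul (hA _ _ _) (hf.norm_batchGrad_le _ _ _ _) (norm_nonneg _) hG)
  have hAg : ∀ t, Integrable (fun ω => (inner ℝ
      (trueGrad f μ 1 T N w₁ t (fun t => J t ω) (fun n => Z n ω))
      (stepGrad f 1 T N w₁ t (fun t => J t ω) (fun n => Z n ω)) : ℝ)) ρ := fun t =>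
    integrable_comp_of_abs_le hJZ (B := G * (G + T * (2 * G)))
      (X := fun q => inner ℝ (trueGrad f μ 1 T N w₁ t q.1 q.2) (stepGrad f 1 T N w₁ t q.1 q.2))
      ((hAm t).inner (measurable_stepGrad t)) fun q => (abs_real_inner_le_norm _ _).trans
        (mul_le_mul (hA _ _ _) (hf.norm_stepGrad_le hG _ _ _) (norm_nonneg _) hG)
  have hAA : ∀ t, Integrable (fun ω =>
      ‖trueGrad f μ 1 T N w₁ t (fun t => J t ω) (fun n => Z n ω)‖ ^ 2) ρ := fun t =>
    integrable_comp_of_abs_le hJZ (B := G ^ 2)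
      (X := fun q => ‖trueGrad f μ 1 T N w₁ t q.1 q.2‖ ^ 2)
      ((hAm t).norm.pow_const 2) fun q => by
        rw [abs_of_nonneg (by positivity)]
        exact pow_le_pow_left₀ (norm_nonneg _) (hA _ _ _) 2
  have hone : ∀ t ∈ Finset.range T,
      ∫ ω, ‖trueGrad f μ 1 T N w₁ t (fun t => J t ω) (fun n => Z n ω)‖ ^ 2 ∂ρ
      ≤ ∫ ω, inner ℝ (trueGrad f μ 1 T N w₁ t (fun t => J t ω) (fun n => Z n ω))
          (stepGrad f 1 T N w₁ t (fun t => J t ω) (fun n => Z n ω)) ∂ρ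
        + 8 * mixingTime P μ * G ^ 2 / 2 ^ Nat.log 2 T := by
    intro t _
    -- ‖∇F‖² is the inner product of ∇F with the largest-batch average minus that with its error;
    -- the former has the same mean as the product with g_t.
    have h1 := hR.abs_integral_inner_levelGrad_sub_le (α := 1) (w₁ := w₁) hZ hP hE hμ hf hG hF hL
      hN t (Nat.log 2 T)
    simp only [inner_sub_right, real_inner_self_eq_norm_sq] at h1
    rw [integral_sub (hAl t _) (hAA t)] at h1
    rw [hR.integral_inner_stepGrad hZ.measurable hμ.mem_stdSimplex hf hG hF hL hT t]
    linarith [(abs_le.1 h1).1]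
  have hgsq := fun t => hR.integral_norm_stepGrad_sq_le (α := 1) (w₁ := w₁) hZ hP hE hμ hf hG hF
    hL hN hT t
  have hVint : Integrable (fun ω => ∑ t ∈ Finset.range T,
      ‖stepGrad f 1 T N w₁ t (fun t => J t ω) (fun n => Z n ω)‖ ^ 2) ρ :=
    integrable_finsetSum _ fun t _ => (hgsq t).1
  have hV0 : ∀ ω, 0 ≤ ∑ t ∈ Finset.range T,
      ‖stepGrad f 1 T N w₁ t (fun t => J t ω) (fun n => Z n ω)‖ ^ 2 := fun ω =>
    Finset.sum_nonneg fun t _ => by positivity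
  have hVs : Integrable (fun ω => √(∑ t ∈ Finset.range T,
      ‖stepGrad f 1 T N w₁ t (fun t => J t ω) (fun n => Z n ω)‖ ^ 2)) ρ := by
    refine ((integrable_const (1 : ℝ)).add hVint).mono'
      (Real.continuous_sqrt.comp_aestronglyMeasurable hVint.aestronglyMeasurable)
      (ae_of_all _ fun ω => ?_)
    rw [Real.norm_of_nonneg (Real.sqrt_nonneg _), Pi.add_apply, Real.sqrt_le_iff]
    have := hV0 ω
    constructor
    · positivity
    · nlinarith
  calc _ ≤ ∑ t ∈ Finset.range T,
        (∫ ω, inner ℝ (trueGrad f μ 1 T N w₁ t (fun t => J t ω) (fun n => Z n ω))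
          (stepGrad f 1 T N w₁ t (fun t => J t ω) (fun n => Z n ω)) ∂ρ
        + 8 * mixingTime P μ * G ^ 2 / 2 ^ Nat.log 2 T) := Finset.sum_le_sum hone
    _ = ∫ ω, ∑ t ∈ Finset.range T,
          inner ℝ (trueGrad f μ 1 T N w₁ t (fun t => J t ω) (fun n => Z n ω))
          (stepGrad f 1 T N w₁ t (fun t => J t ω) (fun n => Z n ω)) ∂ρ
        + T * (8 * mixingTime P μ * G ^ 2 / 2 ^ Nat.log 2 T) := by
        rw [Finset.sum_add_distrib, integral_finsetSum _ fun t _ => hAg t, Finset.sum_const,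
          Finset.card_range, nsmul_eq_mul]
    _ ≤ _ := by
        gcongr
        refine (integral_mono (integrable_finsetSum _ fun t _ => hAg t)
          (hVs.const_mul (2 * M + 2 * L)) fun ω => hF.sum_inner_stepGrad_le hL hM _ _ T).trans ?_
        rw [integral_const_mul]
        gcongr
        -- Jensen's inequality moves the expectation under the square root, where the second moments
        -- add up.
        refine Real.le_sqrt_of_sq_le ?_
        refine (sq_integral_le_integral_sq hVs (by simpa only [Real.sq_sqrt (hV0 _)] using
          hVint)).trans ?_
        simp only [Real.sq_sqrt (hV0 _)]
        rw [integral_finsetSum _ fun t _ => (hgsq t).1]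
        refine (Finset.sum_le_sum fun t _ => (hgsq t).2).trans_eq ?_
        rw [Finset.sum_const, Finset.card_range, nsmul_eq_mul]

end Rate

/-! ### Elementary inequalities for the final rate. -/

/-- Here x stands for √(τ/T), K for ⌊log₂ T⌋, l for log T and q for 2^K. The bias is of order x²,
and x ≤ 1 absorbs it into the main term of order x. The constant 28 comes from 28² = 784 ≥ 2 · 384,
and 56 is 2 · 28. -/
lemma rate_le {M L G t τ l K q x : ℝ} (hM : 0 ≤ M) (hL : 0 ≤ L) (hG : 0 ≤ G) (ht : 1 ≤ t)
    (hτ1 : 1 ≤ τ) (hl : 0 ≤ l) (hKl : K ≤ 2 * l) (hq : t ≤ 2 * q)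
    (hx0 : 0 ≤ x) (hx1 : x ≤ 1) (hx : t * x ^ 2 = τ) :
    ((2 * M + 2 * L) * √(t * (2 * G ^ 2 + 384 * (K * τ) * G ^ 2))
      + t * (8 * τ * G ^ 2 / q)) / t ≤ 56 * ((M + L + G) * G) * (1 + l) * x := by
  have hq0 : 0 < q := by linarith
  have h1 : √(t * (2 * G ^ 2 + 384 * (K * τ) * G ^ 2)) ≤ 28 * G * (1 + l) * (t * x) := by
    rw [Real.sqrt_le_iff]
    refine ⟨by positivity, ?_⟩
    have e : (28 * G * (1 + l) * (t * x)) ^ 2 = t * (784 * (1 + l) ^ 2 * τ * G ^ 2) := by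
      rw [← hx]; ring
    rw [e]
    refine mul_le_mul_of_nonneg_left ?_ (by linarith)
    rw [← add_mul]
    refine mul_le_mul_of_nonneg_right ?_ (by positivity)
    have h2 : K * τ ≤ 2 * l * τ := mul_le_mul_of_nonneg_right hKl (by linarith)
    have h3 : 0 ≤ l * τ := by positivity
    have h4 : 0 ≤ l ^ 2 * τ := by positivity
    linarith
  have h2 : 8 * τ * G ^ 2 / q ≤ 16 * x * G ^ 2 := by
    rw [div_le_iff₀ hq0, ← hx]
    have h3 : t * x ^ 2 ≤ 2 * q * x := by
      rw [pow_two, ← mul_assoc]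
      calc t * x * x ≤ t * x * 1 := mul_le_mul_of_nonneg_left hx1 (by positivity)
        _ = t * x := mul_one _
        _ ≤ 2 * q * x := mul_le_mul_of_nonneg_right hq hx0
    have h4 := mul_le_mul_of_nonneg_right h3 (show 0 ≤ 8 * G ^ 2 by positivity)
    linarith
  have h3 := mul_le_mul_of_nonneg_left h1 (show 0 ≤ 2 * M + 2 * L by positivity)
  have h4 := mul_le_mul_of_nonneg_left h2 (show 0 ≤ t by linarith)
  rw [div_le_iff₀ (by linarith)]
  have h5 : 0 ≤ l * x * G ^ 2 * t := by positivity
  have h6 : 0 ≤ x * G ^ 2 * t := by positivity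
  linarith

/-- Since 56(1 + l) ≤ 64(1 + l)², the constant 8 and the full power of the logarithm suffice. -/
lemma le_mul_sqrt_mul_rpow {a c l r : ℝ} (hc : 0 ≤ c) (hl : 0 ≤ l) (hr : 0 ≤ r)
    (h : a ^ 2 ≤ 56 * c * (1 + l) * √r) : a ≤ 8 * (1 + l) ^ 1 * (√c * r ^ (1 / 4 : ℝ)) := by
  have hy : (r ^ (1 / 4 : ℝ)) ^ 2 = √r := by
    rw [Real.sqrt_eq_rpow, ← Real.rpow_natCast, ← Real.rpow_mul hr]
    norm_num
  have hy0 : 0 ≤ r ^ (1 / 4 : ℝ) := Real.rpow_nonneg hr _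
  refine le_of_sq_le_sq (h.trans ?_) (by positivity)
  rw [mul_pow, mul_pow, mul_pow, hy, Real.sq_sqrt hc, pow_one]
  have h1 : 0 ≤ c * √r := by positivity
  have h2 : 0 ≤ l * (c * √r) := by positivity
  have h3 : 0 ≤ l ^ 2 * (c * √r) := by positivity
  linarith

theorem mainTheorem4 :
    ∃ (C : ℝ) (p : ℕ), 0 < C ∧
      ∀ {Ω : Type*} [MeasurableSpace Ω] (ρ : Measure Ω) [IsProbabilityMeasure ρ]
        {S : Type*} [Fintype S] [DecidableEq S] [MeasurableSpace S] [MeasurableSingletonClass S]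
        (P : Matrix S S ℝ) (μ : S → ℝ) (Z : ℕ → Ω → S)
        (d : ℕ) (f : EuclideanSpace ℝ (Fin d) → S → ℝ) (M L G : ℝ)
        (T : ℕ) (N : ℕ → ℕ) (w₁ : EuclideanSpace ℝ (Fin d)) (J : ℕ → Ω → ℕ) (I : Ω → Fin T),
        P ∈ Matrix.rowStochastic ℝ S → IsErgodicMatrix P → IsStationaryDistribution P μ →
        IsMarkovChain P Z ρ →
        0 < M → 0 ≤ L → 0 < G →
        IsLSmooth (objective f μ) L →
        (∀ w, |objective f μ w| ≤ M) →
        HasBoundedGradients f G →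
        1 ≤ T → IsSampleCount T N →
        IsMAGRandomness T Z J I ρ →
        Integrable (fun ω => ‖∇ (objective f μ)
            (magIterate f 1 T N w₁ (fun n => Z n ω) (fun t => J t ω) (I ω))‖) ρ ∧
        ∫ ω, ‖∇ (objective f μ)
            (magIterate f 1 T N w₁ (fun n => Z n ω) (fun t => J t ω) (I ω))‖ ∂ρ ≤
          C * (1 + Real.log T) ^ p * (√((M + L + G) * G) *
            ((mixingTime P μ : ℝ) / T) ^ (1 / 4 : ℝ)) := by
  refine ⟨8, 1, by norm_num, ?_⟩
  intro Ω _ ρ _ S _ _ _ _ P μ Z d f M L G T N w₁ J I hP hE hμ hZ hM0 hL hG hF hM hf hT hN hR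
  have hAG : ∀ t j z, ‖trueGrad f μ 1 T N w₁ t j z‖ ≤ G := fun t j z =>
    hf.norm_gradient_objective_le hμ.mem_stdSimplex _
  have hAm := fun t => measurable_trueGrad (α := 1) (T := T) (N := N) (w₁ := w₁) hF hL t
  obtain ⟨hint, -⟩ := hR.integral_index hZ.measurable
    (X := fun t j z => ‖trueGrad f μ 1 T N w₁ t j z‖) (fun t => (hAm t).norm) (B := G)
    fun t j z => by rw [abs_of_nonneg (norm_nonneg _)]; exact hAG t j z
  obtain ⟨hint2, havg⟩ := hR.integral_index hZ.measurable
    (X := fun t j z => ‖trueGrad f μ 1 T N w₁ t j z‖ ^ 2) (fun t => (hAm t).norm.pow_const 2)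
    (B := G ^ 2) fun t j z => by
      rw [abs_of_nonneg (by positivity)]
      exact pow_le_pow_left₀ (norm_nonneg _) (hAG t j z) 2
  refine ⟨hint, ?_⟩
  have hT' : (1 : ℝ) ≤ T := by exact_mod_cast hT
  have hτ1 : (1 : ℝ) ≤ mixingTime P μ := by exact_mod_cast (mixingTime_spec hP hE hμ).1
  have hlog : 0 ≤ Real.log T := Real.log_nonneg hT'
  have hr0 : (0 : ℝ) ≤ (mixingTime P μ : ℝ) / T := by positivity
  -- If τ > T, the claim already follows from ‖∇F‖ ≤ G ≤ √((M + L + G)G).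
  rcases le_total (mixingTime P μ : ℝ) T with hτT | hTτ
  · refine le_mul_sqrt_mul_rpow (by positivity) hlog hr0
      ((sq_integral_le_integral_sq hint hint2).trans ?_)
    refine (havg.trans_le (div_le_div_of_nonneg_right
      (hR.sum_integral_norm_trueGrad_sq_le hZ hP hE hμ hf hG.le hF hL hM0.le hM hN hT)
      (Nat.cast_nonneg T))).trans ?_
    refine rate_le hM0.le hL hG.le hT' hτ1 hlog ?_ ?_ (Real.sqrt_nonneg _) ?_ ?_
    -- Passing to the natural logarithm costs 1/log 2 < 2.
    · have h1 : Real.log 2 * Nat.log 2 T ≤ Real.log T := by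
        rw [mul_comm, ← Real.log_pow]
        exact Real.log_le_log (by positivity) (by exact_mod_cast Nat.pow_log_le_self 2 (by omega))
      have h2 := Real.log_two_gt_d9
      have h3 : (0 : ℝ) ≤ Nat.log 2 T := Nat.cast_nonneg _
      nlinarith
    · have := (Nat.lt_pow_succ_log_self (b := 2) (by norm_num) T).le
      rw [pow_succ, mul_comm] at this
      exact_mod_cast this
    · exact Real.sqrt_le_one.2 (div_le_one_of_le₀ hτT (by positivity))
    · rw [Real.sq_sqrt hr0]
      field_simp
  · have h1 : ∫ ω, ‖trueGrad f μ 1 T N w₁ (I ω) (fun t => J t ω) (fun n => Z n ω)‖ ∂ρ ≤ G := by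
      refine (integral_mono hint (integrable_const G) fun ω => hAG _ _ _).trans_eq ?_
      simp
    refine h1.trans ?_
    have h2 : G ≤ √((M + L + G) * G) := Real.le_sqrt_of_sq_le (by
      rw [add_mul, ← pow_two]
      exact le_add_of_nonneg_left (by positivity))
    have h3 : 1 ≤ ((mixingTime P μ : ℝ) / T) ^ (1 / 4 : ℝ) :=
      Real.one_le_rpow ((one_le_div (by linarith)).2 hTτ) (by norm_num)
    have h4 : 1 ≤ 8 * (1 + Real.log T) ^ 1 := by rw [pow_one]; linarith
    calc G = 1 * (G * 1) := by ring
      _ ≤ _ := mul_le_mul h4 (mul_le_mul h2 h3 zero_le_one (Real.sqrt_nonneg _)) (by positivity)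
          (by positivity)
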